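/- Let $k\ge 1$ and $n_1,\dots,n_k\ge 1$ be integers, let $B_n$ and $S_n$ denote the open unit ball and the unit sphere of $\mathbb C^n$, and put $\mathcal D=B_{n_1}\times\cdots\times B_{n_k}$, $\partial\mathcal D=S_{n_1}\times\cdots\times S_{n_k}$. Let $\Sigma$ be the normalized Lebesgue measure on $\partial\mathcal D$ (the product of the normalized surface measures on the spheres $S_{n_j}$), and let $m$ be the normalized Lebesgue measure on the unit circle $\mathbb T$. With $$C(z,\zeta)=\prod_{j=1}^k\frac1{(1-\langle z_j,\zeta_j\rangle)^{n_j}},\qquad P(z,\zeta)=\frac{C(z,\zeta)\,C(\zeta,z)}{C(z,z)},\qquad z\in\mathcal D,\ \zeta\in\partial\mathcal D,$$ write $P[\mu](z)=\int_{\partial\mathcal D}P(z,\zeta)\,d\mu(\zeta)$ for a finite Borel measure $\mu$ on $\partial\mathcal D$. Let $I$ be an inner function on $\mathcal D$, that is, a holomorphic function $I:\mathcal D\to\{w\in\mathbb C:|w|<1\}$ such that for $\Sigma$-almost every $\zeta\in\partial\mathcal D$ the radial limit $\lim_{r\to1-}I(r\zeta)$ exists and has modulus $1$. For $\alpha\in\mathbb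 T$ let $\sigma_\alpha=\sigma_\alpha[I]$ be the Clark measure of $I$, that is, the unique finite positive Borel measure on $\partial\mathcal D$ such that $$P[\sigma_\alpha](z)=\mathrm{Re}\,\frac{\alpha+I(z)}{\alpha-I(z)},\qquad z\in\mathcal D.$$ Then for every $g\in L^1(\Sigma)$: (i) for $m$-almost every $\alpha\in\mathbb T$, $g$ is defined $\sigma_\alpha$-almost everywhere and is $\sigma_\alpha$-integrable; here "defined" means that if $g_1,g_2$ are any two representatives of $g$, then $g_1=g_2$ $\sigma_\alpha$-almost everywhere for $m$-almost every $\alpha$; (ii) the function $\alpha\mapsto\int_{\partial\mathcal D}g\,d\sigma_\alpha$ is $m$-integrable, and $$\int_{\mathbb T}\int_{\partial\mathcal D}g\,d\sigma_\alpha\,dm(\alpha)=\int_{\partial\mathcal D}g\,d\Sigma .$$ -/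

import Mathlib

open MeasureTheory Filter Topology

noncomputable section

namespace PolyBall

/-- The ambient space `ℂ^{n₁} × ⋯ × ℂ^{n_k}`; each factor carries its Hermitian norm. -/
abbrev Ambient {k : ℕ} (n : Fin k → ℕ) : Type :=
  (j : Fin k) → EuclideanSpace ℂ (Fin (n j))

/-- The unit sphere `S_n` of `ℂ^n`. -/
abbrev USphere (n : ℕ) : Type :=
  Metric.sphere (0 : EuclideanSpace ℂ (Fin n)) 1

/-- The distinguished boundary `∂𝒟 = S_{n₁} × ⋯ × S_{n_k}`. -/
abbrev Bdry {k : ℕ} (n : Fin k → ℕ) : Type :=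
  (j : Fin k) → USphere (n j)

/-- The product of open unit balls `𝒟 = B_{n₁} × ⋯ × B_{n_k}`. -/
def dom {k : ℕ} (n : Fin k → ℕ) : Set (Ambient n) :=
  {z | ∀ j, z j ∈ Metric.ball (0 : EuclideanSpace ℂ (Fin (n j))) 1}

/-- A boundary point, seen as a point of the ambient space. -/
def Bdry.toAmbient {k : ℕ} {n : Fin k → ℕ} (ζ : Bdry n) : Ambient n :=
  fun j => (ζ j : EuclideanSpace ℂ (Fin (n j)))

/-- The surface measure on `S_n` induced by Lebesgue (Haar) measure of `ℂ^n`,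
normalized to total mass one. -/
def sphereMeasure (n : ℕ) : Measure (USphere n) :=
  let ν : Measure (USphere n) :=
    (Measure.addHaar : Measure (EuclideanSpace ℂ (Fin n))).toSphere
  (ν Set.univ)⁻¹ • ν

/-- Normalized Lebesgue measure `Σ` on the distinguished boundary. -/
def bdryMeasure {k : ℕ} (n : Fin k → ℕ) : Measure (Bdry n) :=
  Measure.pi fun j => sphereMeasure (n j)

/-- The unit circle `𝕋` carries its Borel σ-algebra. -/
instance instMeasurableSpaceCircle : MeasurableSpace Circle := borel Circle

instance instBorelSpaceCircle : BorelSpace Circle := ⟨rfl⟩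

/-- Normalized Lebesgue (arc length) measure `m` on the unit circle `𝕋`:
the law of `exp (i θ)` with `θ` uniformly distributed on `(0, 2π]`. -/
def circleMeasure : Measure Circle :=
  (ENNReal.ofReal (2 * Real.pi))⁻¹ •
    Measure.map Circle.exp ((volume : Measure ℝ).restrict (Set.Ioc 0 (2 * Real.pi)))

/-- The Cauchy kernel `C(z, ζ) = ∏ⱼ (1 - ⟨zⱼ, ζⱼ⟩)^{-nⱼ}` with `⟨z, ζ⟩ = ∑ z_i conj(ζ_i)`
(Mathlib's `inner` is conjugate-linear in its first argument). -/
def cauchyKernel {k : ℕ} {n : Fin k → ℕ} (z ζ : Ambient n) : ℂ :=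
  ∏ j, 1 / (1 - inner ℂ (ζ j) (z j)) ^ n j

/-- The Poisson type kernel `P(z, ζ) = C(z, ζ) C(ζ, z) / C(z, z)`. -/
def poissonKernel {k : ℕ} {n : Fin k → ℕ} (z : Ambient n) (ζ : Bdry n) : ℂ :=
  cauchyKernel z ζ.toAmbient * cauchyKernel ζ.toAmbient z / cauchyKernel z z

/-- The Poisson integral `P[μ](z) = ∫ P(z, ζ) dμ(ζ)`. -/
def poissonIntegral {k : ℕ} {n : Fin k → ℕ} (μ : Measure (Bdry n)) (z : Ambient n) : ℂ :=
  ∫ ζ, poissonKernel z ζ ∂μ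

/-- `I : 𝒟 → 𝔻` is an inner function: it is holomorphic and, for `Σ`-almost every
`ζ`, the radial limit `lim_{r → 1-} I(r ζ)` exists and has modulus one.
Only the values of `I` on `𝒟` matter. -/
structure IsInner {k : ℕ} {n : Fin k → ℕ} (I : Ambient n → ℂ) : Prop where
  holo : DifferentiableOn ℂ I (dom n)
  maps : ∀ z ∈ dom n, ‖I z‖ < 1
  radial : ∀ᵐ ζ ∂(bdryMeasure n), ∃ w : ℂ, ‖w‖ = 1 ∧
    Tendsto (fun r : ℝ => I ((r : ℂ) • ζ.toAmbient)) (𝓝[<] 1) (𝓝 w)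

/-- The defining property of the Clark measure: a finite positive Borel measure `μ` on `∂𝒟` with
`P[μ](z) = Re ((α + I(z)) / (α - I(z)))` for all `z ∈ 𝒟`. -/
structure IsClarkMeasure {k : ℕ} {n : Fin k → ℕ} (I : Ambient n → ℂ) (α : Circle)
    (μ : Measure (Bdry n)) : Prop where
  finite : IsFiniteMeasure μ
  poisson : ∀ z ∈ dom n,
    poissonIntegral μ z = (((((α : ℂ) + I z) / ((α : ℂ) - I z)).re : ℝ) : ℂ)

open Classical in
/-- The Clark measure `σ_α[I]`: the unique measure with the defining property.
(The value `0` in the other case is never the Clark measure, whose mass is positive.) -/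
def clarkMeasure {k : ℕ} {n : Fin k → ℕ} (I : Ambient n → ℂ) (α : Circle) : Measure (Bdry n) :=
  if h : ∃! μ : Measure (Bdry n), IsClarkMeasure I α μ then Classical.choose h.exists else 0

end PolyBall

end

noncomputable section

open scoped Pointwise

namespace PolyBall

/-! For fixed `w` in the disc, `Re ((α + w) / (α - w))` has mean one over `α ∈ 𝕋`. Taking `w = I z`
shows that the average of the Clark measures has the Poisson integral of `Σ`, namely `1`; since
Poisson integrals determine measures, that average is `Σ`. Extending the identity from continuous
functions to `L¹` is then the general disintegration along a measurable kernel
(`disintegration_of_bind_eq`, `bind_clarkKernel`).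

To make this rigorous, a Clark measure is realized as the weak limit of the densities `herglotz I α
(r ζ) dΣ(ζ)` as `r → 1` (`tendsto_integral_mul_herglotz`). This one fact gives uniqueness,
measurability in `α`, and, after Fubini at each fixed `r`, the averaging identity. Existence follows
from weak compactness.

Two properties of `P` carry the argument: it reproduces functions holomorphic near the closed
polyball (`integral_poissonKernel_mul`), and it is an approximate identity
(`tendsto_integral_realPoisson_mul`). The second follows from the first by a Korovkin argument, the
test functions `‖ζ_j - η_j‖²` being real parts of holomorphic functions on the boundary. The first
rests on the Cauchy formula for one ball: unitary averaging reduces it to a complex line, where the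
moments of `⟨ζ, e⟩` are the reciprocals of the Taylor coefficients of `(1 - x)^{-n}`. -/

abbrev CSpace (n : ℕ) : Type := EuclideanSpace ℂ (Fin n)

/-! ### Unitary invariance of the sphere measure -/

instance sphereMeasure.isProbabilityMeasure (n : ℕ) [NeZero n] :
    IsProbabilityMeasure (sphereMeasure n) := by
  refine ⟨?_⟩
  simp only [sphereMeasure, Measure.smul_apply, smul_eq_mul]
  refine ENNReal.inv_mul_cancel ?_ (measure_ne_top _ _)
  rw [Ne, Measure.measure_univ_eq_zero]
  exact Measure.toSphere_ne_zero _

/-- The action of a linear isometry on the unit sphere. -/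
def sphereMap {n : ℕ} (U : CSpace n ≃ₗᵢ[ℂ] CSpace n) (ζ : USphere n) : USphere n :=
  ⟨U ζ, by simp⟩

@[simp]
lemma coe_sphereMap {n : ℕ} (U : CSpace n ≃ₗᵢ[ℂ] CSpace n) (ζ : USphere n) :
    (sphereMap U ζ : CSpace n) = U ζ := rfl

/-- The image is again a Haar measure, hence a multiple of the original; the invariant unit ball
forces the factor to be one. -/
lemma measurePreserving_addHaar_linearIsometryEquiv {n : ℕ} (U : CSpace n ≃ₗᵢ[ℂ] CSpace n) :
    MeasurePreserving U (Measure.addHaar : Measure (CSpace n)) Measure.addHaar := by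
  refine ⟨U.continuous.measurable, ?_⟩
  set μ : Measure (CSpace n) := Measure.addHaar
  have h1 : (μ.map U).IsAddHaarMeasure :=
    U.toContinuousLinearEquiv.toContinuousAddEquiv.isAddHaarMeasure_map μ
  obtain ⟨c, hc⟩ := (⟨_, Measure.isAddLeftInvariant_eq_smul (μ.map U) μ⟩ : ∃ c : NNReal, μ.map U = c • μ)
  have hb : μ.map U (Metric.ball 0 1) = μ (Metric.ball 0 1) := by
    rw [Measure.map_apply U.continuous.measurable Metric.isOpen_ball.measurableSet,
      U.preimage_ball, map_zero]
  rw [hc, Measure.smul_apply] at hb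
  have h0 : μ (Metric.ball 0 1) ≠ 0 := (Metric.measure_ball_pos μ 0 one_pos).ne'
  have h2 : μ (Metric.ball 0 1) ≠ ⊤ := measure_ball_lt_top.ne
  have : (c : ENNReal) = 1 := by
    rw [← ENNReal.mul_left_inj h0 h2, one_mul]
    simpa [ENNReal.smul_def] using hb
  rw [hc, show c = 1 by exact_mod_cast this, one_smul]

/-- Up to a constant, `toSphere` measures a set by the Haar volume of the cone over it, and a linear
isometry carries cones to cones. -/
lemma measurePreserving_sphereMap {n : ℕ} (U : CSpace n ≃ₗᵢ[ℂ] CSpace n) :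
    MeasurePreserving (sphereMap U) (sphereMeasure n) (sphereMeasure n) := by
  have hc : Continuous (sphereMap U) := by unfold sphereMap; fun_prop
  refine ⟨hc.measurable, ?_⟩
  simp only [sphereMeasure, Measure.map_smul]
  congr 1
  ext s hs
  rw [Measure.map_apply hc.measurable hs, Measure.toSphere_apply' _ hs,
    Measure.toSphere_apply' _ (hc.measurable hs)]
  congr 1
  rw [← (measurePreserving_addHaar_linearIsometryEquiv U).measure_preimage_equiv
     (f := U.toHomeomorph.toMeasurableEquiv) (Set.Ioo (0 : ℝ) 1 • (Subtype.val '' s))]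
  congr 1
  ext w
  simp only [Set.mem_smul, Set.mem_image, Set.mem_preimage]
  constructor
  · rintro ⟨r, hr, _, ⟨ζ, hζ, rfl⟩, rfl⟩
    refine ⟨r, hr, _, ⟨_, hζ, rfl⟩, ?_⟩
    exact (map_smul (U.toLinearEquiv.restrictScalars ℝ) r (ζ : CSpace n)).symm
  · rintro ⟨r, hr, _, ⟨ζ, hζ, rfl⟩, (h : r • (ζ : CSpace n) = U w)⟩
    refine ⟨r, hr, _, ⟨sphereMap U.symm ζ, ?_, rfl⟩, ?_⟩
    · convert hζ
      ext1
      simp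
    · apply U.injective
      refine Eq.trans ?_ h
      refine (map_smul (U.toLinearEquiv.restrictScalars ℝ) r _).trans ?_
      simp

lemma measurableEmbedding_sphereMap {n : ℕ} (U : CSpace n ≃ₗᵢ[ℂ] CSpace n) :
    MeasurableEmbedding (sphereMap U) := by
  have hc : ∀ V : CSpace n ≃ₗᵢ[ℂ] CSpace n, Continuous (sphereMap V) := fun V => by
    unfold sphereMap; fun_prop
  let H : USphere n ≃ₜ USphere n :=
    { toFun := sphereMap U
      invFun := sphereMap U.symm
      left_inv := fun ζ => by ext1; simp
      right_inv := fun ζ => by ext1; simp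
      continuous_toFun := hc U
      continuous_invFun := hc U.symm }
  exact H.measurableEmbedding

lemma integral_comp_sphereMap {n : ℕ} {F : Type*} [NormedAddCommGroup F] [NormedSpace ℝ F]
    (U : CSpace n ≃ₗᵢ[ℂ] CSpace n) (f : USphere n → F) :
    ∫ ζ, f (sphereMap U ζ) ∂sphereMeasure n = ∫ ζ, f ζ ∂sphereMeasure n :=
  (measurePreserving_sphereMap U).integral_comp (measurableEmbedding_sphereMap U) f

/-! ### Moments on the sphere via Gaussian integrals -/

lemma integral_Ioi_pow_mul_exp_neg_sq (q : ℕ) :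
    ∫ r in Set.Ioi (0 : ℝ), r ^ (2 * q + 1) * Real.exp (-r ^ 2) = q.factorial / 2 := by
  have h := integral_rpow_mul_exp_neg_rpow (p := 2) (q := ((2 * q + 1 : ℕ) : ℝ)) (by norm_num)
    (by have : (0 : ℝ) ≤ ((2 * q + 1 : ℕ) : ℝ) := by positivity
        linarith)
  simp only [Real.rpow_natCast, Real.rpow_ofNat] at h
  rw [h, show (((2 * q + 1 : ℕ) : ℝ) + 1) / 2 = q + 1 by push_cast; ring,
    Real.Gamma_nat_eq_factorial]
  ring

lemma integral_complex_norm_pow_mul_exp_neg_sq (m : ℕ) :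
    ∫ x : ℂ, ‖x‖ ^ (2 * m) * Real.exp (-‖x‖ ^ 2) = Real.pi * m.factorial := by
  have h := Complex.integral_rpow_mul_exp_neg_rpow (p := 2) (q := ((2 * m : ℕ) : ℝ)) (by norm_num)
    (by have : (0 : ℝ) ≤ ((2 * m : ℕ) : ℝ) := by positivity
        linarith)
  simp only [Real.rpow_natCast, Real.rpow_ofNat] at h
  rw [h, show (((2 * m : ℕ) : ℝ) + 2) / 2 = m + 1 by push_cast; ring,
    Real.Gamma_nat_eq_factorial]
  ring

/-- Haar measure is a multiple of product Lebesgue measure and the Gaussian factorizes: coordinate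
`i` contributes `π m!`, every other one `π`. Only the independence of `c` from `m` matters, since
`c` cancels later. -/
lemma exists_integral_gaussian_moment (n : ℕ) :
    ∃ c : ℝ, ∀ (i : Fin n) (m : ℕ),
      ∫ w : CSpace n, ‖w i‖ ^ (2 * m) * Real.exp (-‖w‖ ^ 2) ∂Measure.addHaar =
        c * m.factorial := by
  let L : (Fin n → ℂ) ≃L[ℝ] CSpace n :=
    (PiLp.continuousLinearEquiv 2 ℝ (fun _ : Fin n => ℂ)).symm
  have hL : (Measure.map L volume).IsAddHaarMeasure := L.isAddHaarMeasure_map volume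
  let c := Measure.addHaarScalarFactor (Measure.addHaar : Measure (CSpace n)) (Measure.map L volume)
  have hc : (Measure.addHaar : Measure (CSpace n)) = c • Measure.map L volume :=
    Measure.isAddLeftInvariant_eq_smul _ _
  have hme : MeasurableEmbedding L := L.toHomeomorph.measurableEmbedding
  refine ⟨c * Real.pi ^ n, fun i m => ?_⟩
  rw [hc, integral_smul_nnreal_measure,
    hme.integral_map (μ := volume) (g := fun w : CSpace n =>
      ‖w i‖ ^ (2 * m) * Real.exp (-‖w‖ ^ 2))]
  have h1 : ∀ x : Fin n → ℂ, ‖(L x) i‖ ^ (2 * m) *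
      Real.exp (-‖L x‖ ^ 2) =
      ∏ j, (‖x j‖ ^ (2 * if j = i then m else 0) * Real.exp (-‖x j‖ ^ 2)) := by
    intro x
    have hx : ∀ j, (L x) j = x j := fun j => rfl
    rw [EuclideanSpace.norm_sq_eq, Finset.prod_mul_distrib, ← Real.exp_sum,
      Finset.sum_neg_distrib]
    simp only [hx]
    congr 1
    rw [Finset.prod_eq_single i] <;> simp +contextual
  simp_rw [h1]
  rw [integral_fintype_prod_volume_eq_prod (fun j (x : ℂ) =>
    ‖x‖ ^ (2 * if j = i then m else 0) * Real.exp (-‖x‖ ^ 2))]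
  simp_rw [integral_complex_norm_pow_mul_exp_neg_sq]
  rw [Finset.prod_mul_distrib, Finset.prod_const, Finset.card_univ, Fintype.card_fin,
    Finset.prod_eq_single i, NNReal.smul_def]
  · simp; ring
  · simp +contextual
  · simp

lemma integral_polar {n : ℕ} [NeZero n] (Φ : USphere n → ℝ) (g : ℝ → ℝ) (h : CSpace n → ℝ)
    (hh : ∀ (ζ : USphere n) (r : ℝ), 0 < r → h (r • (ζ : CSpace n)) = Φ ζ * g r) :
    ∫ w : CSpace n, h w ∂Measure.addHaar =
      (∫ ζ, Φ ζ ∂(Measure.addHaar : Measure (CSpace n)).toSphere) *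
        ∫ r in Set.Ioi (0 : ℝ), r ^ (2 * n - 1) * g r := by
  set μ : Measure (CSpace n) := Measure.addHaar
  have hdim : Module.finrank ℝ (CSpace n) = 2 * n := by
    rw [finrank_real_of_complex, finrank_euclideanSpace_fin]
  calc
    ∫ w, h w ∂μ = ∫ x : ({(0)}ᶜ : Set (CSpace n)), h x.1 ∂(μ.comap (↑)) := by
      rw [integral_subtype_comap (measurableSet_singleton _).compl h, restrict_compl_singleton]
    _ = ∫ x, Φ x.1 * g x.2 ∂μ.toSphere.prod (.volumeIoiPow (Module.finrank ℝ (CSpace n) - 1)) := by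
      rw [← μ.measurePreserving_homeomorphUnitSphereProd.integral_comp
        (Homeomorph.measurableEmbedding _)]
      congr 1
      ext x
      rw [← hh _ _ (Set.mem_Ioi.1 (homeomorphUnitSphereProd (CSpace n) x).2.2)]
      congr 1
      exact (congrArg Subtype.val ((homeomorphUnitSphereProd (CSpace n)).symm_apply_apply x)).symm
    _ = (∫ ζ, Φ ζ ∂μ.toSphere) *
        ∫ x : Set.Ioi (0 : ℝ), g x ∂.volumeIoiPow (Module.finrank ℝ (CSpace n) - 1) :=
      integral_prod_mul Φ (fun x : Set.Ioi (0 : ℝ) => g x)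
    _ = _ := by
      simp only [Measure.volumeIoiPow, ENNReal.ofReal]
      rw [integral_withDensity_eq_integral_smul, hdim,
        integral_subtype_comap measurableSet_Ioi fun a ↦ Real.toNNReal (a ^ (2 * n - 1)) • g a,
        setIntegral_congr_fun measurableSet_Ioi fun x hx ↦ ?_]
      · rw [NNReal.smul_def, Real.coe_toNNReal _ (pow_nonneg hx.out.le _), smul_eq_mul]
      · exact (measurable_subtype_coe.pow_const _).real_toNNReal

/-- The Gaussian moment is computed both in product and in polar coordinates. The case `m = 0`
eliminates the unknown constant and the total mass. -/
lemma integral_sphere_coord {n : ℕ} [NeZero n] (i : Fin n) (m : ℕ) :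
    ((m + (n - 1)).choose (n - 1) : ℝ) *
      ∫ ζ : USphere n, ‖(ζ : CSpace n) i‖ ^ (2 * m) ∂sphereMeasure n = 1 := by
  set ν := (Measure.addHaar : Measure (CSpace n)).toSphere
  obtain ⟨c, hc⟩ := exists_integral_gaussian_moment n
  have hn : 1 ≤ n := NeZero.one_le
  have key : ∀ m : ℕ, (∫ ζ : USphere n, ‖(ζ : CSpace n) i‖ ^ (2 * m) ∂ν) *
      ((n - 1 + m).factorial / 2) = c * m.factorial := by
    intro m
    rw [← hc i m, ← integral_Ioi_pow_mul_exp_neg_sq, integral_polar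
      (fun ζ : USphere n => ‖(ζ : CSpace n) i‖ ^ (2 * m))
      (fun r => r ^ (2 * m) * Real.exp (-r ^ 2))]
    · congr 1
      refine setIntegral_congr_fun measurableSet_Ioi fun r _ => ?_
      rw [← mul_assoc, ← pow_add]
      congr 2
      omega
    · intro ζ r hr
      simp only [PiLp.smul_apply, norm_smul, norm_eq_of_mem_sphere, mul_one,
        Real.norm_eq_abs, abs_of_pos hr, mul_pow]
      ring
  have h0 := key 0
  have hm := key m
  simp only [mul_zero, pow_zero, integral_const, smul_eq_mul, mul_one, add_zero,
    Nat.factorial_zero, Nat.cast_one] at h0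
  have hν : ν.real Set.univ ≠ 0 := by
    rw [Measure.real, ENNReal.toReal_ne_zero]
    exact ⟨by simpa using Measure.toSphere_ne_zero _, measure_ne_top _ _⟩
  have hσ : ∫ ζ : USphere n, ‖(ζ : CSpace n) i‖ ^ (2 * m) ∂sphereMeasure n =
      (ν.real Set.univ)⁻¹ * ∫ ζ : USphere n, ‖(ζ : CSpace n) i‖ ^ (2 * m) ∂ν := by
    rw [sphereMeasure, integral_smul_measure, ENNReal.toReal_inv]
    rfl
  rw [hσ,]
  have hch : ((m + (n - 1)).choose (n - 1) : ℝ) * (n - 1).factorial * m.factorial =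
      (n - 1 + m).factorial := by
    have := Nat.add_choose_mul_factorial_mul_factorial (n - 1) m
    rw [add_comm m, ← this, Nat.choose_symm_add]
    push_cast
    ring
  have hf : ((n - 1 + m).factorial : ℝ) ≠ 0 := by positivity
  have e : ∫ ζ : USphere n, ‖(ζ : CSpace n) i‖ ^ (2 * m) ∂ν =
      ν.real Set.univ * ((n - 1).factorial / 2) * m.factorial * 2 / (n - 1 + m).factorial := by
    rw [h0, ← hm]
    field_simp
  rw [e]
  field_simp
  linear_combination hch

/-- The moments of `⟨ζ, e⟩` over the unit sphere, for a unit vector `e`. -/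
lemma choose_mul_integral_norm_inner_pow {n : ℕ} [NeZero n] {e : CSpace n} (he : ‖e‖ = 1) (m : ℕ) :
    ((m + (n - 1)).choose (n - 1) : ℝ) *
      ∫ ζ : USphere n, ‖(inner ℂ e (ζ : CSpace n) : ℂ)‖ ^ (2 * m) ∂sphereMeasure n = 1 := by
  -- The coordinates of an orthonormal basis containing `e` give a unitary map that turns `⟨ζ, e⟩`
  -- into a coordinate.
  have ho : Orthonormal ℂ (({0} : Set (Fin n)).domRestrict fun _ => e) := by
    refine ⟨fun i => he, fun i j hij => ?_⟩
    exact absurd (Subsingleton.elim i j) hij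
  obtain ⟨b, hb⟩ := ho.exists_orthonormalBasis_extension_of_card_eq (by simp)
  have hb0 : b 0 = e := hb 0 rfl
  have h := integral_sphere_coord (0 : Fin n) m
  rw [← integral_comp_sphereMap b.repr] at h
  simpa [b.repr_apply_apply, hb0] using h

/-! ### Circle averages and the Cauchy formula on the ball -/

section

instance circleMeasure.isProbabilityMeasure : IsProbabilityMeasure circleMeasure := by
  refine ⟨?_⟩
  rw [circleMeasure, Measure.smul_apply, Measure.map_apply Circle.exp.continuous.measurable .univ]
  simp only [Set.preimage_univ, Measure.restrict_apply_univ, Real.volume_Ioc, sub_zero, smul_eq_mul]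
  exact ENNReal.inv_mul_cancel (by simp [Real.pi_pos]) ENNReal.ofReal_ne_top

lemma integral_circleMeasure {F : Type*} [NormedAddCommGroup F] [NormedSpace ℝ F]
    {f : Circle → F} (hf : Continuous f) :
    ∫ α, f α ∂circleMeasure = (2 * Real.pi)⁻¹ • ∫ θ in 0..2 * Real.pi, f (Circle.exp θ) := by
  rw [circleMeasure, integral_smul_measure, integral_map Circle.exp.continuous.aemeasurable
    hf.aestronglyMeasurable, intervalIntegral.integral_of_le (by positivity)]
  simp [ENNReal.toReal_ofReal Real.pi_pos.le]

/-- The mean value property on the unit disc. -/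
lemma integral_circleMeasure_of_diffContOnCl {h : ℂ → ℂ}
    (hd : DiffContOnCl ℂ h (Metric.ball 0 1)) :
    ∫ α : Circle, h α ∂circleMeasure = h 0 := by
  have hc : Continuous fun α : Circle => h α := by
    have := hd.continuousOn_ball
    exact this.comp_continuous continuous_subtype_val fun α => by simp [Circle.norm_coe]
  rw [integral_circleMeasure hc]
  have := DiffContOnCl.circleAverage (f := h) (c := 0) (R := 1) (by simpa using hd)
  rw [← this, Real.circleAverage_def]
  simp [circleMap]

lemma integrable_of_continuous {X F : Type*} [TopologicalSpace X] [CompactSpace X]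
    [MeasurableSpace X] [OpensMeasurableSpace X] [NormedAddCommGroup F] [SecondCountableTopology F]
    {μ : Measure X} [IsFiniteMeasure μ] {f : X → F} (hf : Continuous f) : Integrable f μ :=
  hf.integrable_of_hasCompactSupport (HasCompactSupport.of_compactSpace f)

variable {n : ℕ}

lemma norm_sq_line_decomposition {e : CSpace n} (he : ‖e‖ = 1) (c d : ℂ) (w : CSpace n) :
    ‖(c * inner ℂ e w) • e + d • (w - (inner ℂ e w : ℂ) • e)‖ ^ 2 =
      ‖c * (inner ℂ e w : ℂ)‖ ^ 2 + (‖d‖ * ‖w - (inner ℂ e w : ℂ) • e‖) ^ 2 := by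
  have := norm_add_sq_eq_norm_sq_add_norm_sq_of_inner_eq_zero (𝕜 := ℂ)
    ((c * inner ℂ e w) • e) (d • (w - (inner ℂ e w : ℂ) • e)) (by
      simp only [inner_smul_left, inner_smul_right, inner_sub_right, inner_self_eq_norm_sq_to_K, he]
      simp only [RCLike.ofReal_one]
      ring)
  rw [sq, this, norm_smul, norm_smul, he, mul_one]
  ring

/-- The unitary map multiplying by `a` on the line spanned by the unit vector `e` and by `b` on
its orthogonal complement. -/
lemma exists_linearIsometryEquiv_line {e : CSpace n} (he : ‖e‖ = 1) (a b : Circle) :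
    ∃ U : CSpace n ≃ₗᵢ[ℂ] CSpace n, ∀ w, U w =
      ((a : ℂ) * inner ℂ e w) • e + (b : ℂ) • (w - (inner ℂ e w : ℂ) • e) := by
  let T : CSpace n →ₗ[ℂ] CSpace n :=
    { toFun := fun w => ((a : ℂ) * inner ℂ e w) • e + (b : ℂ) • (w - (inner ℂ e w : ℂ) • e)
      map_add' := fun v w => by simp only [inner_add_right]; module
      map_smul' := fun c w => by simp only [inner_smul_right, RingHom.id_apply]; module }
  have hT : ∀ w, ‖T w‖ = ‖w‖ := by
    intro w
    rw [← sq_eq_sq₀ (norm_nonneg _) (norm_nonneg _)]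
    refine (norm_sq_line_decomposition he a b w).trans ?_
    have h2 := norm_sq_line_decomposition he 1 1 w
    simp only [one_mul, one_smul, add_sub_cancel, norm_one] at h2
    rw [h2]
    simp [Circle.norm_coe]
  let L : CSpace n →ₗᵢ[ℂ] CSpace n := ⟨T, hT⟩
  exact ⟨L.toLinearIsometryEquiv rfl, fun w => rfl⟩

lemma norm_inner_sphere_le {e : CSpace n} (he : ‖e‖ = 1) (ζ : USphere n) :
    ‖(inner ℂ e (ζ : CSpace n) : ℂ)‖ ≤ 1 := by
  refine (norm_inner_le_norm _ _).trans ?_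
  simp [he]

lemma norm_inner_sphere_le' {e : CSpace n} (he : ‖e‖ = 1) (ζ : USphere n) :
    ‖(inner ℂ (ζ : CSpace n) e : ℂ)‖ ≤ 1 := by
  rw [norm_inner_symm]; exact norm_inner_sphere_le he ζ

lemma one_sub_ne_zero {s x : ℂ} (hs : ‖s‖ < 1) (hx : ‖x‖ ≤ 1) : 1 - s * x ≠ 0 := by
  intro h
  have : ‖s * x‖ = 1 := by rw [← sub_eq_zero.1 h]; simp
  rw [norm_mul] at this
  nlinarith [norm_nonneg s, norm_nonneg x]

lemma continuous_kernel_line {e : CSpace n} (he : ‖e‖ = 1) {s : ℂ} (hs : ‖s‖ < 1) :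
    Continuous fun ζ : USphere n => 1 / (1 - s * inner ℂ (ζ : CSpace n) e) ^ n := by
  refine continuous_const.div (by fun_prop) fun ζ => pow_ne_zero _ ?_
  exact one_sub_ne_zero hs (norm_inner_sphere_le' he ζ)

/-- Rotating the line of `e` by `ω` multiplies the integrand by `ω ^ (m - l)`. The angle `π / (m -
l)` makes this factor `-1`, so the integral equals its own negative. -/
lemma integral_inner_pow_mul_conj_pow {e : CSpace n} (he : ‖e‖ = 1) {m l : ℕ} (hml : m ≠ l) :
    ∫ ζ : USphere n, (inner ℂ e (ζ : CSpace n) : ℂ) ^ m * (inner ℂ (ζ : CSpace n) e) ^ l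
      ∂sphereMeasure n = 0 := by
  set ω : Circle := Circle.exp (Real.pi / ((m : ℝ) - l))
  obtain ⟨U, hU⟩ := exists_linearIsometryEquiv_line he ω 1
  have hX : ∀ w, (inner ℂ e (U w) : ℂ) = ω * inner ℂ e w := by
    intro w
    simp [hU, he]
  have hX' : ∀ w, (inner ℂ (U w) e : ℂ) = starRingEnd ℂ ω * inner ℂ w e := by
    intro w
    rw [← inner_conj_symm, hX, map_mul, inner_conj_symm]
  have h := integral_comp_sphereMap U (fun ζ : USphere n =>
    (inner ℂ e (ζ : CSpace n) : ℂ) ^ m * (inner ℂ (ζ : CSpace n) e) ^ l)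
  simp only [coe_sphereMap, hX, hX'] at h
  have hω : (ω : ℂ) ^ m * (starRingEnd ℂ ω) ^ l = -1 := by
    have hne : ((m : ℂ) - l) ≠ 0 := sub_ne_zero.2 (by exact_mod_cast hml)
    simp only [ω, Circle.coe_exp, ← Complex.exp_conj, ← Complex.exp_nat_mul, ← Complex.exp_add]
    rw [← Complex.exp_pi_mul_I]
    congr 1
    simp only [map_mul, Complex.conj_ofReal, Complex.conj_I]
    push_cast
    field_simp
    ring
  have h2 : ∀ ζ : USphere n, (ω * (inner ℂ e (ζ : CSpace n) : ℂ)) ^ m *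
      (starRingEnd ℂ ω * inner ℂ (ζ : CSpace n) e) ^ l =
      (-1) * ((inner ℂ e (ζ : CSpace n) : ℂ) ^ m * (inner ℂ (ζ : CSpace n) e) ^ l) := by
    intro ζ
    rw [← hω]
    ring
  simp only [h2, integral_const_mul] at h
  linear_combination (-1 / 2) * h

variable [NeZero n]

lemma integral_inner_pow_mul_conj_pow_self {e : CSpace n} (he : ‖e‖ = 1) (m : ℕ) :
    ((m + (n - 1)).choose (n - 1) : ℂ) *
    ∫ ζ : USphere n, (inner ℂ e (ζ : CSpace n) : ℂ) ^ m * (inner ℂ (ζ : CSpace n) e) ^ m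
      ∂sphereMeasure n = 1 := by
  have h := choose_mul_integral_norm_inner_pow he m
  have h2 : ∀ ζ : USphere n, (inner ℂ e (ζ : CSpace n) : ℂ) ^ m * (inner ℂ (ζ : CSpace n) e) ^ m =
      ((‖(inner ℂ e (ζ : CSpace n) : ℂ)‖ ^ (2 * m) : ℝ) : ℂ) := by
    intro ζ
    rw [← mul_pow, ← inner_conj_symm (ζ : CSpace n) e, Complex.mul_conj, pow_mul,
      Complex.normSq_eq_norm_sq]
    push_cast
    rfl
  simp only [h2, integral_complex_ofReal]
  exact_mod_cast h

/-- In the binomial series of the kernel only the term `l = m` survives integration, and its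
coefficient cancels the moment. -/
lemma integral_inner_pow_mul_kernel {e : CSpace n} (he : ‖e‖ = 1) {s : ℂ} (hs : ‖s‖ < 1) (m : ℕ) :
    ∫ ζ : USphere n, (inner ℂ e (ζ : CSpace n) : ℂ) ^ m *
      (1 / (1 - s * inner ℂ (ζ : CSpace n) e) ^ n) ∂sphereMeasure n = s ^ m := by
  have hn : n - 1 + 1 = n := Nat.sub_add_cancel NeZero.one_le
  let F : ℕ → USphere n → ℂ := fun l ζ => (inner ℂ e (ζ : CSpace n) : ℂ) ^ m *
    (((l + (n - 1)).choose (n - 1) : ℂ) * (s * inner ℂ (ζ : CSpace n) e) ^ l)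
  have hFs : ∀ ζ, HasSum (fun l => F l ζ) ((inner ℂ e (ζ : CSpace n) : ℂ) ^ m *
      (1 / (1 - s * inner ℂ (ζ : CSpace n) e) ^ n)) := by
    intro ζ
    have h1 : ‖s * inner ℂ (ζ : CSpace n) e‖ < 1 := by
      rw [norm_mul]
      nlinarith [norm_nonneg s, norm_inner_sphere_le' he ζ,
        norm_nonneg (inner ℂ (ζ : CSpace n) e : ℂ)]
    have := hasSum_choose_mul_geometric_of_norm_lt_one (n - 1) h1
    rw [hn] at this
    exact this.mul_left _
  have hFc : ∀ l, Continuous (F l) := fun l => by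
    simp only [F]; fun_prop
  have hFn : ∀ l ζ, ‖F l ζ‖ ≤ ((l + (n - 1)).choose (n - 1) : ℝ) * ‖s‖ ^ l := by
    intro l ζ
    have h1 := norm_inner_sphere_le he ζ
    have h2 := norm_inner_sphere_le' he ζ
    simp only [F, norm_mul, norm_pow, Complex.norm_natCast, mul_pow]
    calc _ ≤ 1 ^ m * (((l + (n - 1)).choose (n - 1) : ℝ) * (‖s‖ ^ l * 1 ^ l)) := by gcongr
      _ = _ := by ring
  have hsum : Summable fun l => ((l + (n - 1)).choose (n - 1) : ℝ) * ‖s‖ ^ l :=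
    summable_choose_mul_geometric_of_norm_lt_one (n - 1) (by simpa using hs)
  have hint := hasSum_integral_of_summable_integral_norm (F := F) (μ := sphereMeasure n)
    (fun l => integrable_of_continuous (hFc l))
    (hsum.of_nonneg_of_le (fun l => integral_nonneg fun _ => norm_nonneg _) fun l => by
      refine (integral_mono (integrable_of_continuous (hFc l).norm)
        (integrable_const _) (hFn l)).trans ?_
      simp)
  simp only [(hFs _).tsum_eq] at hint
  have hterm : ∀ l, ∫ ζ, F l ζ ∂sphereMeasure n = if l = m then s ^ m else 0 := by
    intro l
    have : ∀ ζ, F l ζ = (((l + (n - 1)).choose (n - 1) : ℂ) * s ^ l) *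
      ((inner ℂ e (ζ : CSpace n) : ℂ) ^ m * (inner ℂ (ζ : CSpace n) e) ^ l) := by
      intro ζ; simp only [F]; ring
    simp only [this, integral_const_mul]
    split_ifs with h
    · subst h
      linear_combination s ^ l * integral_inner_pow_mul_conj_pow_self he l
    · rw [integral_inner_pow_mul_conj_pow he (Ne.symm h), mul_zero]
  simp only [hterm] at hint
  exact hint.unique (hasSum_ite_eq m (s ^ m))

lemma integral_comp_inner_mul_kernel {e : CSpace n} (he : ‖e‖ = 1) {s : ℂ} (hs : ‖s‖ < 1)
    {f : ℂ → ℂ} {R : ℝ} (hR : 1 < R) (hf : DifferentiableOn ℂ f (Metric.ball 0 R)) :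
    ∫ ζ : USphere n, f (inner ℂ e (ζ : CSpace n)) *
      (1 / (1 - s * inner ℂ (ζ : CSpace n) e) ^ n) ∂sphereMeasure n = f s := by
  obtain ⟨a, ha⟩ : ∃ a : ℕ → ℂ, ∀ x ∈ Metric.ball (0 : ℂ) R,
      HasSum (fun m => a m * x ^ m) (f x) := by
    refine ⟨fun m => (m.factorial : ℂ)⁻¹ * iteratedDeriv m f 0, fun x hx => ?_⟩
    simpa only [sub_zero, smul_eq_mul, mul_assoc, mul_comm (iteratedDeriv _ f 0)] using
      Complex.hasSum_taylorSeries_on_ball hf hx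
  -- Convergence at a radius `ρ > 1` makes the Taylor coefficients absolutely summable, which
  -- justifies termwise integration.
  obtain ⟨ρ, hρ1, hρR⟩ := exists_between hR
  have hasum : Summable fun m => ‖a m‖ := by
    have h1 := (ha (ρ : ℂ) (by simp [abs_of_pos (zero_lt_one.trans hρ1), hρR])).summable.norm
    refine h1.of_nonneg_of_le (fun _ => norm_nonneg _) fun m => ?_
    rw [norm_mul (a m), norm_pow, Complex.norm_real, Real.norm_eq_abs,
      abs_of_pos (zero_lt_one.trans hρ1)]
    exact le_mul_of_one_le_right (norm_nonneg _) (one_le_pow₀ hρ1.le)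
  have hKc := continuous_kernel_line he hs
  obtain ⟨C, hC⟩ := (isCompact_range hKc).isBounded.exists_norm_le
  have hC' : ∀ ζ : USphere n, ‖1 / (1 - s * inner ℂ (ζ : CSpace n) e) ^ n‖ ≤ C :=
    fun ζ => hC _ ⟨ζ, rfl⟩
  let F : ℕ → USphere n → ℂ := fun m ζ => a m * ((inner ℂ e (ζ : CSpace n) : ℂ) ^ m *
    (1 / (1 - s * inner ℂ (ζ : CSpace n) e) ^ n))
  have hFc : ∀ m, Continuous (F m) := fun m =>
    continuous_const.mul (Continuous.mul (by fun_prop) hKc)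
  have hFs : ∀ ζ, HasSum (fun m => F m ζ) (f (inner ℂ e (ζ : CSpace n)) *
      (1 / (1 - s * inner ℂ (ζ : CSpace n) e) ^ n)) := by
    intro ζ
    have := (ha (inner ℂ e (ζ : CSpace n)) (by
      simpa using (norm_inner_sphere_le he ζ).trans_lt hR)).mul_right
        (1 / (1 - s * inner ℂ (ζ : CSpace n) e) ^ n)
    simpa only [F, mul_assoc] using this
  have hFn : ∀ m ζ, ‖F m ζ‖ ≤ ‖a m‖ * C := by
    intro m ζ
    have h1 := norm_inner_sphere_le he ζ
    rw [norm_mul, norm_mul, norm_pow]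
    calc _ ≤ ‖a m‖ * (1 ^ m * C) := by gcongr; exact hC' ζ
      _ = _ := by ring
  have hint := hasSum_integral_of_summable_integral_norm (F := F) (μ := sphereMeasure n)
    (fun m => integrable_of_continuous (hFc m))
    ((hasum.mul_right C).of_nonneg_of_le (fun m => integral_nonneg fun _ => norm_nonneg _)
      fun m => by
        refine (integral_mono (integrable_of_continuous (hFc m).norm)
          (integrable_const _) (hFn m)).trans ?_
        simp)
  simp only [(hFs _).tsum_eq] at hint
  have hterm : ∀ m, ∫ ζ, F m ζ ∂sphereMeasure n = a m * s ^ m := fun m => by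
    simp only [F, integral_const_mul, integral_inner_pow_mul_kernel he hs]
  simp only [hterm] at hint
  exact hint.unique (ha s (by simpa using hs.trans hR))

/-- The kernel sees only `⟨ζ, e⟩`, so `G` may be averaged over the rotations `b` of the orthogonal
complement of `e`. By the mean value property in `b` the average is the value at `b = 0`, which
involves `G` on the line of `e` only. -/
lemma integral_mul_kernel_line {e : CSpace n} (he : ‖e‖ = 1) {s : ℂ} (hs : ‖s‖ < 1)
    {G : CSpace n → ℂ} {R : ℝ} (hR : 1 < R) (hG : DifferentiableOn ℂ G (Metric.ball 0 R)) :
    ∫ ζ : USphere n, G ζ * (1 / (1 - s * inner ℂ (ζ : CSpace n) e) ^ n) ∂sphereMeasure n =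
      G (s • e) := by
  let q : ℂ → CSpace n → CSpace n := fun b w =>
    (inner ℂ e w : ℂ) • e + b • (w - (inner ℂ e w : ℂ) • e)
  have hU : ∀ b : Circle, ∃ U : CSpace n ≃ₗᵢ[ℂ] CSpace n, ∀ w, U w = q b w := by
    intro b
    obtain ⟨U, hU⟩ := exists_linearIsometryEquiv_line he 1 b
    exact ⟨U, fun w => by rw [hU]; simp [q]⟩
  have hqn : ∀ (b : Circle) (w : CSpace n), ‖q b w‖ = ‖w‖ := by
    intro b w
    obtain ⟨U, hU⟩ := hU b
    rw [← hU, U.norm_map]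
  have hball : ∀ (b : Circle) (ζ : USphere n), q b ζ ∈ Metric.ball (0 : CSpace n) R := by
    intro b ζ
    simpa [hqn] using hR
  have hKc := continuous_kernel_line he hs
  have h1 : ∀ b : Circle, ∫ ζ : USphere n, G (q b ζ) *
      (1 / (1 - s * inner ℂ (ζ : CSpace n) e) ^ n) ∂sphereMeasure n =
      ∫ ζ : USphere n, G ζ * (1 / (1 - s * inner ℂ (ζ : CSpace n) e) ^ n) ∂sphereMeasure n := by
    intro b
    obtain ⟨U, hU⟩ := hU b
    rw [← integral_comp_sphereMap U (fun ζ : USphere n =>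
      G ζ * (1 / (1 - s * inner ℂ (ζ : CSpace n) e) ^ n))]
    congr 1
    ext ζ
    have : (inner ℂ (U ζ) e : ℂ) = inner ℂ (ζ : CSpace n) e := by
      rw [← inner_conj_symm, ← inner_conj_symm (ζ : CSpace n) e, hU]
      simp [q, inner_add_right, inner_smul_right, inner_sub_right, he]
    simp only [coe_sphereMap, this]
    rw [hU]
  have h2 : ∀ ζ : USphere n, ∫ b : Circle, G (q b ζ) ∂circleMeasure =
      G ((inner ℂ e (ζ : CSpace n) : ℂ) • e) := by
    intro ζ
    -- By Pythagoras, shrinking the component orthogonal to `e` does not increase the norm, so the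
    -- whole closed disc of `b` is admissible.
    have hmaps : Set.MapsTo (fun b : ℂ => q b ζ) (Metric.closedBall 0 1) (Metric.ball 0 R) := by
      intro b hb
      have hb : ‖b‖ ≤ 1 := by simpa using hb
      have h3 := norm_sq_line_decomposition he 1 b (ζ : CSpace n)
      have h4 := norm_sq_line_decomposition he 1 1 (ζ : CSpace n)
      simp only [one_mul, one_smul, add_sub_cancel, norm_one, norm_eq_of_mem_sphere] at h3 h4
      have h5 : (‖b‖ * ‖(ζ : CSpace n) - (inner ℂ e (ζ : CSpace n) : ℂ) • e‖) ^ 2 ≤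
          ‖(ζ : CSpace n) - (inner ℂ e (ζ : CSpace n) : ℂ) • e‖ ^ 2 := by
        gcongr
        exact mul_le_of_le_one_left (norm_nonneg _) hb
      have h6 : ‖q b ζ‖ ^ 2 ≤ 1 ^ 2 := by simp only [q]; linarith
      rw [mem_ball_zero_iff]
      exact (abs_le_of_sq_le_sq' h6 zero_le_one).2.trans_lt hR
    have hd : DiffContOnCl ℂ (fun b : ℂ => G (q b ζ)) (Metric.ball 0 1) := by
      refine DifferentiableOn.diffContOnCl ?_
      rw [closure_ball _ one_ne_zero]
      exact hG.comp (by simp only [q]; fun_prop) hmaps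
    rw [integral_circleMeasure_of_diffContOnCl hd]
    simp [q]
  calc _ = ∫ b : Circle, (∫ ζ : USphere n, G (q b ζ) *
      (1 / (1 - s * inner ℂ (ζ : CSpace n) e) ^ n) ∂sphereMeasure n) ∂circleMeasure := by
        simp only [h1, integral_const, probReal_univ, one_smul]
    _ = ∫ ζ : USphere n, (∫ b : Circle, G (q b ζ) *
      (1 / (1 - s * inner ℂ (ζ : CSpace n) e) ^ n) ∂circleMeasure) ∂sphereMeasure n := by
        refine integral_integral_swap_of_hasCompactSupport ?_ (HasCompactSupport.of_compactSpace _)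
        refine Continuous.mul ?_ (hKc.comp continuous_snd)
        have hq2 : Continuous fun p : Circle × USphere n => q p.1 p.2 := by
          simp only [q]; fun_prop
        exact hG.continuousOn.comp_continuous hq2 fun p => hball p.1 p.2
    _ = ∫ ζ : USphere n, G ((inner ℂ e (ζ : CSpace n) : ℂ) • e) *
      (1 / (1 - s * inner ℂ (ζ : CSpace n) e) ^ n) ∂sphereMeasure n := by
        simp only [integral_mul_const, h2]
    _ = _ := by
        refine integral_comp_inner_mul_kernel he hs (f := fun x => G (x • e)) hR ?_
        refine hG.comp (by fun_prop) fun x hx => ?_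
        simpa [norm_smul, he] using hx

/-- The Cauchy formula on the unit ball of `ℂⁿ`. -/
lemma integral_mul_cauchy_ball {G : CSpace n → ℂ} {R : ℝ} (hR : 1 < R)
    (hG : DifferentiableOn ℂ G (Metric.ball 0 R)) {z : CSpace n} (hz : ‖z‖ < 1) :
    ∫ ζ : USphere n, G ζ * (1 / (1 - inner ℂ (ζ : CSpace n) z) ^ n) ∂sphereMeasure n = G z := by
  obtain ⟨e, s, he, hs, rfl⟩ : ∃ (e : CSpace n) (s : ℂ), ‖e‖ = 1 ∧ ‖s‖ < 1 ∧ z = s • e := by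
    rcases eq_or_ne z 0 with rfl | h0
    · exact ⟨EuclideanSpace.single 0 1, 0, by simp, by simp, by simp⟩
    · have : ‖z‖ ≠ 0 := norm_ne_zero_iff.2 h0
      refine ⟨(‖z‖⁻¹ : ℂ) • z, ‖z‖, ?_, ?_, ?_⟩
      · simp [norm_smul, this]
      · simpa using hz
      · rw [smul_smul, mul_inv_cancel₀ (by exact_mod_cast this), one_smul]
  simpa only [inner_smul_right] using integral_mul_kernel_line he hs hR hG

end

/-! ### Reproducing property of the Poisson kernel -/

section

/-- The Poisson–Szegő kernel of the unit ball. -/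
def ballPoisson {n : ℕ} (z ζ : CSpace n) : ℂ :=
  1 / (1 - inner ℂ ζ z) ^ n * (1 / (1 - inner ℂ z ζ) ^ n) / (1 / (1 - inner ℂ z z) ^ n)

lemma poissonKernel_eq_prod {k : ℕ} {n : Fin k → ℕ} (z : Ambient n) (ζ : Bdry n) :
    poissonKernel z ζ = ∏ j, ballPoisson (z j) (ζ j) := by
  simp only [poissonKernel, cauchyKernel, ballPoisson, Bdry.toAmbient, Finset.prod_div_distrib,
    Finset.prod_mul_distrib]

lemma one_sub_inner_ne_zero {n : ℕ} {z w : CSpace n} (h : ‖z‖ * ‖w‖ < 1) :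
    1 - (inner ℂ z w : ℂ) ≠ 0 := by
  intro h0
  have h1 := norm_inner_le_norm (𝕜 := ℂ) z w
  rw [← sub_eq_zero.1 h0, norm_one] at h1
  exact absurd h1 (not_le.2 h)

lemma one_sub_inner_sphere_ne_zero {n : ℕ} {z : CSpace n} (hz : ‖z‖ < 1) (ζ : USphere n) :
    1 - (inner ℂ z (ζ : CSpace n) : ℂ) ≠ 0 :=
  one_sub_inner_ne_zero (by simpa using hz)

lemma one_sub_inner_sphere_ne_zero' {n : ℕ} {z : CSpace n} (hz : ‖z‖ < 1) (ζ : USphere n) :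
    1 - (inner ℂ (ζ : CSpace n) z : ℂ) ≠ 0 :=
  one_sub_inner_ne_zero (by simpa using hz)

lemma continuous_ballPoisson {n : ℕ} {z : CSpace n} (hz : ‖z‖ < 1) :
    Continuous fun ζ : USphere n => ballPoisson z ζ := by
  unfold ballPoisson
  refine Continuous.div_const (Continuous.mul ?_ ?_) _
  · exact continuous_const.div (by fun_prop) fun ζ =>
      pow_ne_zero _ (one_sub_inner_sphere_ne_zero' hz ζ)
  · exact continuous_const.div (by fun_prop) fun ζ =>
      pow_ne_zero _ (one_sub_inner_sphere_ne_zero hz ζ)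

/-- The Poisson–Szegő kernel of the ball reproduces holomorphic functions. -/
lemma integral_ballPoisson_mul {n : ℕ} [NeZero n] {F : CSpace n → ℂ} {R : ℝ} (hR : 1 < R)
    (hF : DifferentiableOn ℂ F (Metric.ball 0 R)) {z : CSpace n} (hz : ‖z‖ < 1) :
    ∫ ζ : USphere n, ballPoisson z ζ * F ζ ∂sphereMeasure n = F z := by
  have hz0 := norm_nonneg z
  -- The second bound gives `‖z‖ * ρ < 1`, so `1 - ⟨w, z⟩` has no zero for `‖w‖ < ρ`.
  set ρ : ℝ := min R (2 / (1 + ‖z‖))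
  have hρ : 1 < ρ := lt_min hR (by rw [lt_div_iff₀ (by linarith)]; linarith)
  -- The factor `C(w, z) / C(z, z)` is holomorphic in `w` and equals one at `w = z`, so the Cauchy
  -- formula for `G` is the Poisson formula for `F`.
  let G : CSpace n → ℂ := fun w => F w * ((1 / (1 - inner ℂ z w) ^ n) / (1 / (1 - inner ℂ z z) ^ n))
  have hG : DifferentiableOn ℂ G (Metric.ball 0 ρ) := by
    have hq : DifferentiableOn ℂ (fun w : CSpace n => 1 / (1 - (inner ℂ z w : ℂ)) ^ n)
        (Metric.ball 0 ρ) := by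
      simp only [one_div]
      refine DifferentiableOn.fun_inv (((differentiableOn_const (1 : ℂ)).sub
        (innerSL ℂ z).differentiable.differentiableOn).pow n) fun w hw => ?_
      refine pow_ne_zero _ (one_sub_inner_ne_zero ?_)
      rw [mem_ball_zero_iff] at hw
      have h2 : ‖w‖ < 2 / (1 + ‖z‖) := hw.trans_le (min_le_right _ _)
      calc ‖z‖ * ‖w‖ ≤ ‖z‖ * (2 / (1 + ‖z‖)) := by gcongr
        _ < 1 := by rw [← mul_div_assoc, div_lt_one (by linarith)]; linarith
    exact (hF.mono (Metric.ball_subset_ball (min_le_left _ _))).mul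
      ((hq.mul_const (1 / (1 - (inner ℂ z z : ℂ)) ^ n)⁻¹).congr fun w _ => div_eq_mul_inv _ _)
  have h := integral_mul_cauchy_ball hρ hG hz
  have hzz : 1 - (inner ℂ z z : ℂ) ≠ 0 := one_sub_inner_ne_zero (by nlinarith)
  have hGz : G z = F z := by
    simp only [G]
    rw [div_self (one_div_ne_zero (pow_ne_zero _ hzz)), mul_one]
  rw [← hGz, ← h]
  congr 1
  ext ζ
  simp only [G, ballPoisson]
  ring

section Product

variable {k : ℕ}

/-- The product of the balls of radius `R`. -/
def polyball (n : Fin k → ℕ) (R : ℝ) : Set (Ambient n) :=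
  {z | ∀ j, z j ∈ Metric.ball (0 : CSpace (n j)) R}

lemma continuous_toAmbient {n : Fin k → ℕ} : Continuous (Bdry.toAmbient (n := n)) := by
  unfold Bdry.toAmbient
  fun_prop

lemma toAmbient_mem_polyball {n : Fin k → ℕ} {R : ℝ} (hR : 1 < R) (ζ : Bdry n) :
    ζ.toAmbient ∈ polyball n R := fun j => by
  simpa [Bdry.toAmbient] using hR

lemma continuous_poissonKernel {n : Fin k → ℕ} {z : Ambient n} (hz : z ∈ dom n) :
    Continuous (poissonKernel z) := by
  simp only [funext (poissonKernel_eq_prod z)]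
  refine continuous_finsetProd _ fun j _ => ?_
  exact (continuous_ballPoisson (mem_ball_zero_iff.1 (hz j))).comp (continuous_apply j)

instance bdryMeasure.isProbabilityMeasure (n : Fin k → ℕ) [∀ j, NeZero (n j)] :
    IsProbabilityMeasure (bdryMeasure n) := by
  unfold bdryMeasure; infer_instance

/-- Splitting off the first factor of the distinguished boundary. -/
def consBdry {n : Fin (k + 1) → ℕ} (p : USphere (n 0) × Bdry fun j : Fin k => n j.succ) : Bdry n :=
  Fin.cons p.1 p.2

lemma continuous_consBdry {n : Fin (k + 1) → ℕ} : Continuous (consBdry (n := n)) := by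
  refine continuous_pi fun j => ?_
  refine Fin.cases ?_ (fun j => ?_) j
  · exact continuous_fst
  · exact (continuous_apply j).comp continuous_snd

lemma map_consBdry (n : Fin (k + 1) → ℕ) [∀ j, NeZero (n j)] :
    Measure.map (consBdry (n := n))
      ((sphereMeasure (n 0)).prod (bdryMeasure fun j : Fin k => n j.succ)) = bdryMeasure n := by
  refine (Measure.pi_eq fun s hs => ?_).symm
  have hpre : consBdry (n := n) ⁻¹' Set.univ.pi s =
      s 0 ×ˢ Set.univ.pi fun j : Fin k => s j.succ := by
    ext p
    simp only [Set.mem_preimage, Set.mem_univ_pi, Set.mem_prod]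
    exact Fin.forall_fin_succ
  rw [Measure.map_apply continuous_consBdry.measurable (MeasurableSet.univ_pi hs), hpre,
    Measure.prod_prod, bdryMeasure, Measure.pi_pi, Fin.prod_univ_succ]

/-- Induction on the number of balls: the kernel is a product, so the last `k` variables are
integrated with the first frozen on its sphere, then the first with the others frozen at `z`. -/
lemma integral_poissonKernel_mul {n : Fin k → ℕ} [∀ j, NeZero (n j)] {F : Ambient n → ℂ} {R : ℝ}
    (hR : 1 < R) (hF : DifferentiableOn ℂ F (polyball n R)) {z : Ambient n} (hz : z ∈ dom n) :
    ∫ ζ, poissonKernel z ζ * F ζ.toAmbient ∂bdryMeasure n = F z := by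
  induction k with
  | zero =>
    rw [bdryMeasure, Measure.pi_of_empty, integral_dirac]
    simp only [poissonKernel_eq_prod, Finset.univ_eq_empty, Finset.prod_empty, one_mul]
    congr 1
    exact Subsingleton.elim _ _
  | succ k ih =>
    have hcont : Continuous fun ζ : Bdry n => poissonKernel z ζ * F ζ.toAmbient :=
      (continuous_poissonKernel hz).mul
        (hF.continuousOn.comp_continuous continuous_toAmbient (toAmbient_mem_polyball hR))
    rw [← map_consBdry, integral_map continuous_consBdry.aemeasurable
      hcont.aestronglyMeasurable]
    refine (integral_prod _
      (integrable_of_continuous (hcont.comp continuous_consBdry))).trans ?_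
    let n' : Fin k → ℕ := fun j => n j.succ
    let z' : Ambient n' := fun j => z j.succ
    have hz' : z' ∈ dom n' := fun j => hz j.succ
    have hcons : ∀ (x : CSpace (n 0)) (y : Ambient n') (ρ : ℝ), x ∈ Metric.ball 0 ρ →
        y ∈ polyball n' ρ → (Fin.cons x y : Ambient n) ∈ polyball n ρ := by
      intro x y ρ hx hy j
      refine Fin.cases ?_ (fun j => ?_) j
      · exact hx
      · exact hy j
    have inner_eq : ∀ η : USphere (n 0),
        ∫ ζ' : Bdry n', poissonKernel z (consBdry (η, ζ')) * F (consBdry (η, ζ')).toAmbient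
          ∂bdryMeasure n' =
        ballPoisson (z 0) η * F (Fin.cons (η : CSpace (n 0)) z' : Ambient n) := by
      intro η
      have hd : DifferentiableOn ℂ (fun y : Ambient n' => F (Fin.cons (η : CSpace (n 0)) y))
          (polyball n' R) := by
        refine hF.comp (fun y hy => DifferentiableAt.differentiableWithinAt ?_)
          fun y hy => hcons _ _ R (by simpa using hR) hy
        rw [differentiableAt_pi]
        refine fun j => Fin.cases ?_ (fun j => ?_) j
        · exact differentiableAt_const _
        · exact differentiableAt_apply j y
      rw [← ih hd hz', ← integral_const_mul]
      congr 1
      ext ζ'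
      have : (consBdry (η, ζ') : Bdry n).toAmbient =
          (Fin.cons (η : CSpace (n 0)) ζ'.toAmbient : Ambient n) := by
        ext1 j
        refine Fin.cases ?_ (fun j => ?_) j <;> rfl
      rw [this, poissonKernel_eq_prod, poissonKernel_eq_prod, Fin.prod_univ_succ, mul_assoc]
      rfl
    refine (integral_congr_ae (Eventually.of_forall inner_eq)).trans ?_
    have hd : DifferentiableOn ℂ (fun x : CSpace (n 0) => F (Fin.cons x z' : Ambient n))
        (Metric.ball 0 R) := by
      refine hF.comp (fun x hx => DifferentiableAt.differentiableWithinAt ?_)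
        fun x hx => hcons _ _ R hx fun j => Metric.ball_subset_ball hR.le (hz' j)
      rw [differentiableAt_pi]
      refine fun j => Fin.cases ?_ (fun j => ?_) j
      · exact differentiableAt_id
      · exact differentiableAt_const _
    rw [integral_ballPoisson_mul hR hd (mem_ball_zero_iff.1 (hz 0))]
    congr 1
    ext1 j
    refine Fin.cases ?_ (fun j => ?_) j <;> rfl

end Product

end

/-! ### The Poisson kernel as an approximate identity -/

section

variable {k : ℕ} {n : Fin k → ℕ}

/-- The kernel `P(z, ζ)` as a real number. -/
def realPoisson (z : Ambient n) (ζ : Bdry n) : ℝ :=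
  ∏ j, ((1 - ‖z j‖ ^ 2) / ‖1 - (inner ℂ (z j) (ζ j : CSpace (n j)) : ℂ)‖ ^ 2) ^ n j

lemma ballPoisson_eq_ofReal {n : ℕ} (z ζ : CSpace n) :
    ballPoisson z ζ = (((1 - ‖z‖ ^ 2) / ‖1 - (inner ℂ z ζ : ℂ)‖ ^ 2) ^ n : ℝ) := by
  have h1 : (1 - (inner ℂ ζ z : ℂ)) = starRingEnd ℂ (1 - inner ℂ z ζ) := by
    rw [map_sub, map_one, inner_conj_symm]
  have h2 : (1 - (inner ℂ z ζ : ℂ)) * starRingEnd ℂ (1 - inner ℂ z ζ) =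
      ((‖1 - (inner ℂ z ζ : ℂ)‖ ^ 2 : ℝ) : ℂ) := by
    rw [Complex.mul_conj, Complex.normSq_eq_norm_sq]
  have h3 : (inner ℂ z z : ℂ) = ((‖z‖ ^ 2 : ℝ) : ℂ) := by
    rw [inner_self_eq_norm_sq_to_K]; simp
  rw [ballPoisson, h1, h3, div_pow]
  push_cast at h2 ⊢
  rw [← h2, mul_pow]
  simp only [div_eq_mul_inv, mul_inv, inv_inv]
  ring

lemma poissonKernel_eq_ofReal (z : Ambient n) (ζ : Bdry n) :
    poissonKernel z ζ = (realPoisson z ζ : ℂ) := by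
  rw [poissonKernel_eq_prod, realPoisson]
  push_cast
  refine Finset.prod_congr rfl fun j _ => ?_
  rw [ballPoisson_eq_ofReal]
  push_cast
  rfl

lemma realPoisson_nonneg {z : Ambient n} (hz : z ∈ dom n) (ζ : Bdry n) : 0 ≤ realPoisson z ζ := by
  refine Finset.prod_nonneg fun j _ => pow_nonneg (div_nonneg ?_ (sq_nonneg _)) _
  have := mem_ball_zero_iff.1 (hz j)
  nlinarith [norm_nonneg (z j)]

lemma continuous_realPoisson {z : Ambient n} (hz : z ∈ dom n) : Continuous (realPoisson z) := by
  have := Complex.continuous_re.comp (continuous_poissonKernel hz)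
  refine this.congr fun ζ => ?_
  simp [poissonKernel_eq_ofReal]

/-- The boundary point `ζ` dilated by `r`. -/
def dilate (r : ℝ) (ζ : Bdry n) : Ambient n := (r : ℂ) • ζ.toAmbient

lemma dilate_apply (r : ℝ) (ζ : Bdry n) (j : Fin k) :
    dilate r ζ j = (r : ℂ) • (ζ j : CSpace (n j)) := rfl

lemma norm_dilate (r : ℝ) (ζ : Bdry n) (j : Fin k) : ‖dilate r ζ j‖ = |r| := by
  simp [dilate_apply, norm_smul]

lemma dilate_mem_dom {r : ℝ} (h0 : 0 ≤ r) (h1 : r < 1) (ζ : Bdry n) : dilate r ζ ∈ dom n :=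
  fun j => by rwa [mem_ball_zero_iff, norm_dilate, abs_of_nonneg h0]

lemma continuous_dilate (r : ℝ) : Continuous (dilate (n := n) r) := by
  have h : Continuous (fun ζ : Bdry n => (r : ℂ) • ζ.toAmbient) :=
    continuous_toAmbient.fun_const_smul _
  exact h

/-- This symmetry lets Fubini transfer the dilation from one boundary variable to the other. -/
lemma realPoisson_dilate_comm (r : ℝ) (ζ η : Bdry n) :
    realPoisson (dilate r ζ) η = realPoisson (dilate r η) ζ := by
  refine Finset.prod_congr rfl fun j _ => ?_
  have h : (1 - (inner ℂ (dilate r ζ j) (η j : CSpace (n j)) : ℂ)) =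
      starRingEnd ℂ (1 - inner ℂ (dilate r η j) (ζ j : CSpace (n j))) := by
    rw [map_sub, map_one, inner_conj_symm, dilate_apply, dilate_apply, inner_smul_left,
      inner_smul_right, Complex.conj_ofReal]
  rw [norm_dilate, norm_dilate, h, RCLike.norm_conj]

lemma continuous_realPoisson_dilate {r : ℝ} (h0 : 0 ≤ r) (h1 : r < 1) :
    Continuous fun p : Bdry n × Bdry n => realPoisson (dilate r p.1) p.2 := by
  simp only [realPoisson, norm_dilate]
  refine continuous_finsetProd _ fun j _ => Continuous.pow (continuous_const.div ?_ ?_) _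
  · refine Continuous.pow (Continuous.norm (continuous_const.sub (Continuous.inner ?_ ?_))) _
    · exact (continuous_apply j).comp ((continuous_dilate r).comp continuous_fst)
    · exact continuous_subtype_val.comp ((continuous_apply j).comp continuous_snd)
  · intro p
    refine pow_ne_zero _ (norm_ne_zero_iff.2 (one_sub_inner_sphere_ne_zero ?_ _))
    rwa [norm_dilate, abs_of_nonneg h0]

/-- A modulus of continuity of Korovkin type. -/
lemma exists_abs_sub_le_add_mul_sum {f : Bdry n → ℝ} (hf : Continuous f) (η : Bdry n) {ε : ℝ}
    (hε : 0 < ε) :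
    ∃ C : ℝ, 0 ≤ C ∧ ∀ ζ : Bdry n,
      |f ζ - f η| ≤ ε + C * ∑ j, ‖(ζ j : CSpace (n j)) - η j‖ ^ 2 := by
  obtain ⟨δ, hδ, hfδ⟩ := Metric.continuousAt_iff.1 hf.continuousAt ε hε
  obtain ⟨M, hM⟩ := (isCompact_range hf).isBounded.exists_norm_le
  have hM' : ∀ ζ, |f ζ| ≤ M := fun ζ => hM _ ⟨ζ, rfl⟩
  have hM0 : 0 ≤ M := (abs_nonneg _).trans (hM' η)
  -- Away from `η` some coordinate differs by at least `δ`, so the sum is at least `δ²` while `f`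
  -- varies by at most `2M`.
  refine ⟨2 * M / δ ^ 2, by positivity, fun ζ => ?_⟩
  have hS : 0 ≤ ∑ j, ‖(ζ j : CSpace (n j)) - η j‖ ^ 2 := Finset.sum_nonneg fun _ _ => sq_nonneg _
  by_cases hd : dist ζ η < δ
  · have := (hfδ hd).le
    rw [Real.dist_eq] at this
    have : 0 ≤ 2 * M / δ ^ 2 * ∑ j, ‖(ζ j : CSpace (n j)) - η j‖ ^ 2 := by positivity
    linarith
  · rw [dist_pi_lt_iff hδ] at hd
    push Not at hd
    obtain ⟨j, hj⟩ := hd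
    have h1 : δ ^ 2 ≤ ∑ j, ‖(ζ j : CSpace (n j)) - η j‖ ^ 2 := by
      refine le_trans ?_ (Finset.single_le_sum
        (f := fun j => ‖(ζ j : CSpace (n j)) - η j‖ ^ 2) (fun _ _ => sq_nonneg _)
        (Finset.mem_univ j))
      rw [Subtype.dist_eq, dist_eq_norm] at hj
      gcongr
    calc |f ζ - f η| ≤ |f ζ| + |f η| := abs_sub _ _
      _ ≤ 2 * M := by linarith [hM' ζ, hM' η]
      _ = 2 * M / δ ^ 2 * δ ^ 2 := by field_simp
      _ ≤ 2 * M / δ ^ 2 * ∑ j, ‖(ζ j : CSpace (n j)) - η j‖ ^ 2 := by gcongr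
      _ ≤ _ := by linarith

/-- A sequence of radii increasing to one. -/
def radius (N : ℕ) : ℝ := 1 - 1 / ((N : ℝ) + 2)

lemma radius_pos (N : ℕ) : 0 < radius N := by
  have : (1 : ℝ) / ((N : ℝ) + 2) < 1 := by
    rw [div_lt_one (by positivity)]
    linarith [(Nat.cast_nonneg N : (0 : ℝ) ≤ N)]
  unfold radius
  linarith

lemma radius_lt_one (N : ℕ) : radius N < 1 := by
  have : 0 < (1 : ℝ) / ((N : ℝ) + 2) := by positivity
  unfold radius
  linarith

lemma tendsto_radius : Tendsto radius atTop (𝓝 1) := by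
  have h : Tendsto (fun N : ℕ => 1 / ((N : ℝ) + 2)) atTop (𝓝 0) := by
    have := (tendsto_natCast_atTop_atTop (R := ℝ)).atTop_add (tendsto_const_nhds (x := (2 : ℝ)))
    simp only [one_div]
    exact this.inv_tendsto_atTop
  unfold radius
  simpa only [sub_zero] using h.const_sub 1

variable [∀ j, NeZero (n j)]

lemma integral_realPoisson_mul_re {F : Ambient n → ℂ} {R : ℝ}
    (hR : 1 < R) (hF : DifferentiableOn ℂ F (polyball n R)) {z : Ambient n} (hz : z ∈ dom n) :
    ∫ ζ, realPoisson z ζ * (F ζ.toAmbient).re ∂bdryMeasure n = (F z).re := by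
  have hcont : Continuous fun ζ : Bdry n => poissonKernel z ζ * F ζ.toAmbient :=
    (continuous_poissonKernel hz).mul
      (hF.continuousOn.comp_continuous continuous_toAmbient (toAmbient_mem_polyball hR))
  rw [← integral_poissonKernel_mul hR hF hz]
  refine Eq.trans ?_ (integral_re (integrable_of_continuous hcont))
  congr 1
  ext ζ
  simp [poissonKernel_eq_ofReal]

lemma integral_realPoisson {z : Ambient n} (hz : z ∈ dom n) :
    ∫ ζ, realPoisson z ζ ∂bdryMeasure n = 1 := by
  simpa using integral_realPoisson_mul_re (F := fun _ => 1) one_lt_two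
    (differentiableOn_const _) hz

/-- Dilation makes `h` holomorphic on the polyball of radius `r⁻¹ > 1`, as the reproducing formula
requires. -/
lemma integral_realPoisson_mul_re_dilate {h : Ambient n → ℂ} (hh : DifferentiableOn ℂ h (dom n))
    {r : ℝ} (h0 : 0 < r) (h1 : r < 1) {z : Ambient n} (hz : z ∈ dom n) :
    ∫ ζ, realPoisson z ζ * (h (dilate r ζ)).re ∂bdryMeasure n = (h ((r : ℂ) • z)).re := by
  refine integral_realPoisson_mul_re (F := fun w : Ambient n => h ((r : ℂ) • w))
    (one_lt_inv₀ h0 |>.2 h1) ?_ hz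
  refine hh.comp (by fun_prop) fun w hw j => ?_
  have := mem_ball_zero_iff.1 (hw j)
  rw [mem_ball_zero_iff, Pi.smul_apply, norm_smul, Complex.norm_real, Real.norm_eq_abs,
    abs_of_pos h0]
  calc r * ‖w j‖ < r * r⁻¹ := by gcongr
    _ = 1 := mul_inv_cancel₀ h0.ne'

/-- On the sphere `‖ζ_j - η_j‖² = 2 - 2 Re ⟨ζ_j, η_j⟩`, so the reproducing formula evaluates the
integral exactly. -/
lemma integral_realPoisson_mul_norm_sub_sq {r : ℝ} (h0 : 0 ≤ r) (h1 : r < 1) (η : Bdry n)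
    (j : Fin k) :
    ∫ ζ, realPoisson (dilate r η) ζ * ‖(ζ j : CSpace (n j)) - η j‖ ^ 2 ∂bdryMeasure n =
      2 - 2 * r := by
  have hz := dilate_mem_dom h0 h1 η
  have hF : DifferentiableOn ℂ (fun w : Ambient n => (inner ℂ (η j : CSpace (n j)) (w j) : ℂ))
      (polyball n 2) :=
    ((innerSL ℂ (η j : CSpace (n j))).differentiable.comp
      (differentiable_apply j)).differentiableOn
  have h2 := integral_realPoisson_mul_re one_lt_two hF hz
  have h3 : (inner ℂ (η j : CSpace (n j)) (dilate r η j) : ℂ).re = r := by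
    rw [dilate_apply, inner_smul_right, inner_self_eq_norm_sq_to_K]
    simp
  rw [h3] at h2
  have hc := continuous_realPoisson hz
  have hpt : ∀ ζ : Bdry n, realPoisson (dilate r η) ζ * ‖(ζ j : CSpace (n j)) - η j‖ ^ 2 =
      2 * realPoisson (dilate r η) ζ - 2 * (realPoisson (dilate r η) ζ *
        (inner ℂ (η j : CSpace (n j)) (ζ.toAmbient j) : ℂ).re) := by
    intro ζ
    have := norm_sub_sq (𝕜 := ℂ) (η j : CSpace (n j)) (ζ j : CSpace (n j))
    rw [norm_sub_rev, this]
    simp only [norm_eq_of_mem_sphere, Bdry.toAmbient, RCLike.re_to_complex]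
    ring
  simp only [hpt]
  rw [integral_sub, integral_const_mul, integral_const_mul, h2, integral_realPoisson hz]
  · ring
  · exact (integrable_of_continuous hc).const_mul _
  · refine (integrable_of_continuous (hc.mul ?_)).const_mul _
    refine Complex.continuous_re.comp (continuous_const.inner ?_)
    exact (continuous_apply j).comp continuous_toAmbient

/-- Poisson integrals of continuous functions converge radially. -/
lemma tendsto_integral_realPoisson_mul {f : Bdry n → ℝ} (hf : Continuous f) (η : Bdry n) :
    Tendsto (fun N => ∫ ζ, realPoisson (dilate (radius N) η) ζ * f ζ ∂bdryMeasure n) atTop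
      (𝓝 (f η)) := by
  rw [Metric.tendsto_atTop']
  intro ε hε
  obtain ⟨C, hC0, hC⟩ := exists_abs_sub_le_add_mul_sum hf η (half_pos hε)
  have hlim : Tendsto (fun N => C * (k * (2 - 2 * radius N))) atTop (𝓝 0) := by
    have := (((tendsto_radius.const_mul 2).const_sub 2).const_mul (k : ℝ)).const_mul C
    simpa using this
  obtain ⟨N₀, hN₀⟩ := eventually_atTop.1 (hlim.eventually_lt_const (half_pos hε))
  refine ⟨N₀, fun N hN => ?_⟩
  have hz := dilate_mem_dom (radius_pos N).le (radius_lt_one N) η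
  have hp := continuous_realPoisson hz
  set p : Bdry n → ℝ := realPoisson (dilate (radius N) η)
  have hD : ∀ j, Continuous fun ζ : Bdry n => ‖(ζ j : CSpace (n j)) - η j‖ ^ 2 := fun j => by
    fun_prop
  have e1 : ∫ ζ, p ζ * f ζ ∂bdryMeasure n - f η = ∫ ζ, p ζ * (f ζ - f η) ∂bdryMeasure n := by
    simp only [mul_sub]
    rw [integral_sub (integrable_of_continuous (hp.mul hf) :
        Integrable (fun ζ => p ζ * f ζ) (bdryMeasure n)) ((integrable_of_continuous hp).mul_const _), integral_mul_const, integral_realPoisson hz,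
      one_mul]
  have e2 : ∫ ζ, p ζ * (ε / 2 + C * ∑ j, ‖(ζ j : CSpace (n j)) - η j‖ ^ 2) ∂bdryMeasure n =
      ε / 2 + C * (k * (2 - 2 * radius N)) := by
    have hpt : ∀ ζ : Bdry n, p ζ * (ε / 2 + C * ∑ j, ‖(ζ j : CSpace (n j)) - η j‖ ^ 2) =
        p ζ * (ε / 2) + C * ∑ j, p ζ * ‖(ζ j : CSpace (n j)) - η j‖ ^ 2 := fun ζ => by
      rw [← Finset.mul_sum]; ring
    simp only [hpt]
    have hi : ∀ j ∈ (Finset.univ : Finset (Fin k)), Integrable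
        (fun ζ : Bdry n => p ζ * ‖(ζ j : CSpace (n j)) - η j‖ ^ 2) (bdryMeasure n) :=
      fun j _ => integrable_of_continuous (hp.mul (hD j))
    rw [integral_add ((integrable_of_continuous hp).mul_const _)
      ((integrable_finsetSum _ hi).const_mul _), integral_mul_const, integral_realPoisson hz,
      integral_const_mul, integral_finsetSum _ hi]
    simp only [p, integral_realPoisson_mul_norm_sub_sq (radius_pos N).le (radius_lt_one N) η,
      Finset.sum_const, Finset.card_univ, Fintype.card_fin, nsmul_eq_mul, one_mul]
  rw [Real.dist_eq, e1]
  calc |∫ ζ, p ζ * (f ζ - f η) ∂bdryMeasure n|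
      ≤ ∫ ζ, |p ζ * (f ζ - f η)| ∂bdryMeasure n := abs_integral_le_integral_abs
    _ ≤ ∫ ζ, p ζ * (ε / 2 + C * ∑ j, ‖(ζ j : CSpace (n j)) - η j‖ ^ 2) ∂bdryMeasure n := by
        refine integral_mono (integrable_of_continuous ?_) (integrable_of_continuous ?_)
          fun ζ => ?_
        · exact (hp.mul (hf.sub continuous_const)).abs
        · exact hp.mul (continuous_const.add (continuous_const.mul
            (continuous_finsetSum _ fun j _ => hD j)))
        · have h0 : 0 ≤ p ζ := realPoisson_nonneg hz ζ
          simp only [abs_mul, abs_of_nonneg h0]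
          exact mul_le_mul_of_nonneg_left (hC ζ) h0
    _ = ε / 2 + C * (k * (2 - 2 * radius N)) := e2
    _ < ε := by linarith [hN₀ N hN.le]

/-- A finite measure is recovered from its Poisson integral. -/
lemma tendsto_integral_mul_poisson {f : Bdry n → ℝ} (hf : Continuous f) (μ : Measure (Bdry n))
    [IsFiniteMeasure μ] :
    Tendsto (fun N => ∫ ζ, f ζ * ∫ η, realPoisson (dilate (radius N) ζ) η ∂μ ∂bdryMeasure n) atTop
      (𝓝 (∫ η, f η ∂μ)) := by
  obtain ⟨M, hM⟩ := (isCompact_range hf).isBounded.exists_norm_le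
  have hM' : ∀ ζ, |f ζ| ≤ M := fun ζ => hM _ ⟨ζ, rfl⟩
  have hjoint : ∀ N, Continuous fun p : Bdry n × Bdry n =>
      realPoisson (dilate (radius N) p.1) p.2 := fun N =>
    continuous_realPoisson_dilate (radius_pos N).le (radius_lt_one N)
  -- Fubini and the symmetry of the kernel turn this into the `μ`-integral of the Poisson integral
  -- of `f`, which is bounded by `sup |f|` and converges to `f`.
  have hsw : ∀ N, ∫ ζ, f ζ * ∫ η, realPoisson (dilate (radius N) ζ) η ∂μ ∂bdryMeasure n =
      ∫ η, ∫ ζ, realPoisson (dilate (radius N) η) ζ * f ζ ∂bdryMeasure n ∂μ := by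
    intro N
    simp only [← integral_const_mul]
    rw [integral_integral_swap_of_hasCompactSupport
      ((hf.comp continuous_fst).mul (hjoint N)) (HasCompactSupport.of_compactSpace _)]
    simp only [realPoisson_dilate_comm (radius N), mul_comm]
  simp only [hsw]
  refine tendsto_integral_of_dominated_convergence (fun _ => M) (fun N => ?_)
    (integrable_const _) (fun N => Eventually.of_forall fun η => ?_)
    (Eventually.of_forall fun η => tendsto_integral_realPoisson_mul hf η)
  · have : Continuous fun p : Bdry n × Bdry n => realPoisson (dilate (radius N) p.1) p.2 * f p.2 :=
      (hjoint N).mul (hf.comp continuous_snd)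
    exact (this.stronglyMeasurable.integral_prod_right
      (ν := bdryMeasure n)).aestronglyMeasurable
  · have hz := dilate_mem_dom (radius_pos N).le (radius_lt_one N) η
    have hp := continuous_realPoisson hz
    refine (norm_integral_le_integral_norm _).trans ?_
    have : ∫ ζ, realPoisson (dilate (radius N) η) ζ * M ∂bdryMeasure n = M := by
      rw [integral_mul_const, integral_realPoisson hz, one_mul]
    refine le_trans ?_ this.le
    refine integral_mono (integrable_of_continuous (hp.mul hf).norm)
      ((integrable_of_continuous hp).mul_const _) fun ζ => ?_
    have h0 := realPoisson_nonneg hz ζ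
    simp only [norm_mul, Real.norm_eq_abs, abs_of_nonneg h0]
    exact mul_le_mul_of_nonneg_left (hM' ζ) h0

end

/-! ### Existence and uniqueness of Clark measures -/

section

variable {k : ℕ} {n : Fin k → ℕ}

/-- The positive pluriharmonic function `Re ((α + I) / (α - I))`. -/
def herglotz (I : Ambient n → ℂ) (α : Circle) (z : Ambient n) : ℝ :=
  (((α : ℂ) + I z) / ((α : ℂ) - I z)).re

lemma circle_sub_ne_zero (α : Circle) {w : ℂ} (hw : ‖w‖ < 1) : (α : ℂ) - w ≠ 0 := by
  intro h
  rw [← sub_eq_zero.1 h, Circle.norm_coe] at hw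
  exact lt_irrefl _ hw

lemma re_add_div_sub_pos (α : Circle) {w : ℂ} (hw : ‖w‖ < 1) :
    0 < (((α : ℂ) + w) / ((α : ℂ) - w)).re := by
  have h0 := circle_sub_ne_zero α hw
  have h1 : ((α : ℂ) + w) / ((α : ℂ) - w) =
      (((α : ℂ) + w) * starRingEnd ℂ ((α : ℂ) - w)) * ((Complex.normSq ((α : ℂ) - w))⁻¹ : ℝ) := by
    rw [div_eq_mul_inv, Complex.inv_def, mul_assoc]
  rw [h1, Complex.re_mul_ofReal]
  refine mul_pos ?_ (inv_pos.2 (Complex.normSq_pos.2 h0))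
  have hα : (α : ℂ).re * (α : ℂ).re + (α : ℂ).im * (α : ℂ).im = 1 := by
    have := Circle.normSq_coe α
    rwa [Complex.normSq_apply] at this
  have hw2 : w.re * w.re + w.im * w.im < 1 := by
    rw [← Complex.normSq_apply, Complex.normSq_eq_norm_sq]
    nlinarith [norm_nonneg w]
  simp only [Complex.mul_re, Complex.add_re, Complex.conj_re, Complex.conj_im, Complex.sub_re,
    Complex.sub_im, Complex.add_im]
  nlinarith

/-- The Poisson kernel of the disc has mean one over the circle. -/
lemma integral_re_add_div_sub {w : ℂ} (hw : ‖w‖ < 1) :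
    ∫ α : Circle, (((α : ℂ) + w) / ((α : ℂ) - w)).re ∂circleMeasure = 1 := by
  -- On the circle `h` is the conjugate of `(α + w) / (α - w)`, but it is holomorphic in `α` across
  -- the closed disc, with `h 0 = 1`.
  let h : ℂ → ℂ := fun a => (1 + starRingEnd ℂ w * a) / (1 - starRingEnd ℂ w * a)
  have hne : ∀ a ∈ Metric.closedBall (0 : ℂ) 1, 1 - starRingEnd ℂ w * a ≠ 0 := fun a ha =>
    one_sub_ne_zero (by rwa [RCLike.norm_conj]) (by simpa using ha)
  have hd : DiffContOnCl ℂ h (Metric.ball 0 1) := by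
    refine DifferentiableOn.diffContOnCl ?_
    rw [closure_ball _ one_ne_zero]
    exact DifferentiableOn.fun_div (by fun_prop) (by fun_prop) hne
  have hmv := integral_circleMeasure_of_diffContOnCl hd
  have hc : Continuous fun α : Circle => h α :=
    hd.continuousOn_ball.comp_continuous continuous_subtype_val fun α => by simp [Circle.norm_coe]
  have hre : ∀ α : Circle, (((α : ℂ) + w) / ((α : ℂ) - w)).re = (h α).re := by
    intro α
    have hα : (α : ℂ) * starRingEnd ℂ (α : ℂ) = 1 := by
      rw [Complex.mul_conj, Circle.normSq_coe, Complex.ofReal_one]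
    have h1 : h α = starRingEnd ℂ (((α : ℂ) + w) / ((α : ℂ) - w)) := by
      have hα0 : (α : ℂ) ≠ 0 := Circle.coe_ne_zero α
      have h2 : starRingEnd ℂ ((α : ℂ) - w) ≠ 0 := by
        rw [Ne, map_eq_zero]; exact circle_sub_ne_zero α hw
      rw [map_div₀, div_eq_div_iff (hne α (by simp [Circle.norm_coe])) h2, map_sub, map_add]
      linear_combination 2 * starRingEnd ℂ w * hα
    rw [h1, Complex.conj_re]
  simp only [hre]
  refine (integral_re (integrable_of_continuous hc)).trans ?_
  rw [hmv]
  simp [h]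

lemma isClarkMeasure_iff (I : Ambient n → ℂ) (α : Circle) (μ : Measure (Bdry n)) :
    IsClarkMeasure I α μ ↔
      IsFiniteMeasure μ ∧ ∀ z ∈ dom n, ∫ ζ, realPoisson z ζ ∂μ = herglotz I α z := by
  have h : ∀ z, poissonIntegral μ z = ((∫ ζ, realPoisson z ζ ∂μ : ℝ) : ℂ) := fun z => by
    simp only [poissonIntegral, poissonKernel_eq_ofReal]
    exact integral_ofReal
  constructor
  · rintro ⟨h1, h2⟩
    refine ⟨h1, fun z hz => ?_⟩
    have := h2 z hz
    rw [h] at this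
    exact_mod_cast this
  · rintro ⟨h1, h2⟩
    refine ⟨h1, fun z hz => ?_⟩
    rw [h, h2 z hz]
    rfl

lemma zero_mem_dom : (0 : Ambient n) ∈ dom n := fun j => by simp

lemma realPoisson_zero (ζ : Bdry n) : realPoisson (0 : Ambient n) ζ = 1 := by
  simp [realPoisson]

section

variable {I : Ambient n → ℂ}

lemma herglotz_pos (hmaps : ∀ z ∈ dom n, ‖I z‖ < 1)
    (α : Circle) {z : Ambient n} (hz : z ∈ dom n) : 0 < herglotz I α z :=
  re_add_div_sub_pos α (hmaps z hz)

lemma differentiableOn_herglotz (hI : DifferentiableOn ℂ I (dom n))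
    (hmaps : ∀ z ∈ dom n, ‖I z‖ < 1) (α : Circle) :
    DifferentiableOn ℂ (fun z => ((α : ℂ) + I z) / ((α : ℂ) - I z)) (dom n) := by
  simp only [div_eq_mul_inv]
  refine DifferentiableOn.fun_mul (by fun_prop) (DifferentiableOn.fun_inv (by fun_prop) ?_)
  exact fun z hz => circle_sub_ne_zero α (hmaps z hz)

lemma continuous_herglotz_dilate (hI : DifferentiableOn ℂ I (dom n))
    (hmaps : ∀ z ∈ dom n, ‖I z‖ < 1) (N : ℕ) :
    Continuous fun p : Circle × Bdry n => herglotz I p.1 (dilate (radius N) p.2) := by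
  have hd : ∀ ζ : Bdry n, dilate (radius N) ζ ∈ dom n :=
    dilate_mem_dom (radius_pos N).le (radius_lt_one N)
  have hIc : Continuous fun p : Circle × Bdry n => I (dilate (radius N) p.2) :=
    hI.continuousOn.comp_continuous ((continuous_dilate _).comp continuous_snd) fun p => hd p.2
  have hα : Continuous fun p : Circle × Bdry n => (p.1 : ℂ) := by fun_prop
  refine Complex.continuous_re.comp (Continuous.div (hα.add hIc) (hα.sub hIc) fun p => ?_)
  exact circle_sub_ne_zero p.1 (hmaps _ (hd p.2))

variable [∀ j, NeZero (n j)]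

/-- A Clark measure is the weak limit of densities that depend only on `I` and `α`. -/
lemma tendsto_integral_mul_herglotz {α : Circle} {μ : Measure (Bdry n)}
    (hμ : IsClarkMeasure I α μ) {f : Bdry n → ℝ} (hf : Continuous f) :
    Tendsto (fun N => ∫ ζ, f ζ * herglotz I α (dilate (radius N) ζ) ∂bdryMeasure n) atTop
      (𝓝 (∫ η, f η ∂μ)) := by
  obtain ⟨h1, h2⟩ := (isClarkMeasure_iff I α μ).1 hμ
  have h3 := tendsto_integral_mul_poisson hf μ
  simpa only [h2 _ (dilate_mem_dom (radius_pos _).le (radius_lt_one _) _)] using h3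

lemma IsClarkMeasure.unique {α : Circle} {μ ν : Measure (Bdry n)}
    (hμ : IsClarkMeasure I α μ) (hν : IsClarkMeasure I α ν) : μ = ν := by
  have := hμ.finite
  have := hν.finite
  refine ext_of_forall_integral_eq_of_IsFiniteMeasure fun f => ?_
  exact tendsto_nhds_unique (tendsto_integral_mul_herglotz hμ f.continuous)
    (tendsto_integral_mul_herglotz hν f.continuous)

lemma integral_realPoisson_mul_herglotz (hI : DifferentiableOn ℂ I (dom n))
    (hmaps : ∀ z ∈ dom n, ‖I z‖ < 1) (α : Circle) (N : ℕ) {z : Ambient n} (hz : z ∈ dom n) :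
    ∫ ζ, realPoisson z ζ * herglotz I α (dilate (radius N) ζ) ∂bdryMeasure n =
      herglotz I α ((radius N : ℂ) • z) :=
  integral_realPoisson_mul_re_dilate (differentiableOn_herglotz hI hmaps α) (radius_pos N)
    (radius_lt_one N) hz

lemma integral_herglotz_dilate (hI : DifferentiableOn ℂ I (dom n))
    (hmaps : ∀ z ∈ dom n, ‖I z‖ < 1) (α : Circle) (N : ℕ) :
    ∫ ζ, herglotz I α (dilate (radius N) ζ) ∂bdryMeasure n = herglotz I α 0 := by
  simpa [realPoisson_zero] using integral_realPoisson_mul_herglotz hI hmaps α N zero_mem_dom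

/-- Existence of Clark measures, by weak compactness. -/
lemma exists_isClarkMeasure (hI : DifferentiableOn ℂ I (dom n))
    (hmaps : ∀ z ∈ dom n, ‖I z‖ < 1) (α : Circle) :
    ∃ μ : Measure (Bdry n), IsClarkMeasure I α μ := by
  set c : ℝ := herglotz I α 0
  have hc : 0 < c := herglotz_pos hmaps α zero_mem_dom
  -- Division by the common mass `c` gives probability measures, whose space is compact because the
  -- boundary is; `c` is restored at the end.
  let u : ℕ → Bdry n → ℝ := fun N ζ => c⁻¹ * herglotz I α (dilate (radius N) ζ)
  have hu : ∀ N, Continuous (u N) := fun N =>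
    continuous_const.mul ((continuous_herglotz_dilate hI hmaps N).comp
      (continuous_const.prodMk continuous_id : Continuous fun ζ : Bdry n => (α, ζ)))
  have hu0 : ∀ N ζ, 0 ≤ u N ζ := fun N ζ => mul_nonneg (inv_nonneg.2 hc.le)
    (herglotz_pos hmaps α (dilate_mem_dom (radius_pos N).le (radius_lt_one N) ζ)).le
  let P : ℕ → Measure (Bdry n) := fun N =>
    (bdryMeasure n).withDensity fun ζ => ENNReal.ofReal (u N ζ)
  have hP : ∀ N, IsProbabilityMeasure (P N) := fun N => by
    refine ⟨?_⟩
    rw [withDensity_apply _ .univ, Measure.restrict_univ, ← ofReal_integral_eq_lintegral_ofReal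
      (integrable_of_continuous (hu N)) (Eventually.of_forall (hu0 N))]
    simp only [u, integral_const_mul, integral_herglotz_dilate hI hmaps]
    rw [inv_mul_cancel₀ hc.ne', ENNReal.ofReal_one]
  have hPint : ∀ N (f : Bdry n → ℝ), ∫ ζ, f ζ ∂P N = ∫ ζ, u N ζ * f ζ ∂bdryMeasure n := by
    intro N f
    rw [integral_withDensity_eq_integral_toReal_smul (hu N).measurable.ennreal_ofReal
      (Eventually.of_forall fun _ => ENNReal.ofReal_lt_top)]
    simp only [ENNReal.toReal_ofReal (hu0 N _), smul_eq_mul]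
  let Q : ℕ → ProbabilityMeasure (Bdry n) := fun N => ⟨P N, hP N⟩
  -- A limit along an ultrafilter replaces the choice of a convergent subsequence.
  obtain ⟨Q₀, -, hQ₀⟩ := isCompact_univ.ultrafilter_le_nhds ((Ultrafilter.of atTop).map Q) (by simp)
  have hlim : Tendsto Q (Ultrafilter.of atTop : Ultrafilter ℕ) (𝓝 Q₀) := hQ₀
  have hle : ((Ultrafilter.of atTop : Ultrafilter ℕ) : Filter ℕ) ≤ atTop := Ultrafilter.of_le _
  rw [ProbabilityMeasure.tendsto_iff_forall_integral_tendsto] at hlim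
  refine ⟨ENNReal.ofReal c • (Q₀ : Measure (Bdry n)), (isClarkMeasure_iff _ _ _).2
    ⟨Measure.smul_finite _ ENNReal.ofReal_ne_top, fun z hz => ?_⟩⟩
  have h1 := hlim (BoundedContinuousFunction.mkOfCompact ⟨_, continuous_realPoisson hz⟩)
  have h2 : ∀ N, ∫ ζ, realPoisson z ζ ∂(Q N : Measure (Bdry n)) =
      c⁻¹ * herglotz I α ((radius N : ℂ) • z) := by
    intro N
    rw [← integral_realPoisson_mul_herglotz hI hmaps α N hz, ← integral_const_mul]
    refine (hPint N _).trans ?_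
    congr 1
    ext ζ
    simp only [u]
    ring
  simp only [BoundedContinuousFunction.mkOfCompact_apply, ContinuousMap.coe_mk, h2] at h1
  have h3 : Tendsto (fun N => c⁻¹ * herglotz I α ((radius N : ℂ) • z)) atTop
      (𝓝 (c⁻¹ * herglotz I α z)) := by
    refine Tendsto.const_mul _ ?_
    have hopen : IsOpen (dom n) := by
      have : dom n = ⋂ j, (fun z : Ambient n => z j) ⁻¹' Metric.ball 0 1 := by
        ext z; simp [dom]
      rw [this]
      exact isOpen_iInter_of_finite fun j => Metric.isOpen_ball.preimage (continuous_apply j)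
    have hca : ContinuousAt (herglotz I α) z := Complex.continuous_re.continuousAt.comp
      ((differentiableOn_herglotz hI hmaps α).continuousOn.continuousAt (hopen.mem_nhds hz))
    refine hca.tendsto.comp ?_
    have : Tendsto (fun N => (radius N : ℂ)) atTop (𝓝 ((1 : ℝ) : ℂ)) :=
      (Complex.continuous_ofReal.tendsto 1).comp tendsto_radius
    simpa using this.smul_const z
  rw [integral_smul_measure, ENNReal.toReal_ofReal hc.le,
    tendsto_nhds_unique h1 (h3.mono_left hle), smul_eq_mul, mul_inv_cancel_left₀ hc.ne']

/-- Existence and uniqueness together exclude the default value `0`. -/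
lemma isClarkMeasure_clarkMeasure (hI : DifferentiableOn ℂ I (dom n))
    (hmaps : ∀ z ∈ dom n, ‖I z‖ < 1) (α : Circle) : IsClarkMeasure I α (clarkMeasure I α) := by
  obtain ⟨μ, hμ⟩ := exists_isClarkMeasure hI hmaps α
  have h : ∃! μ : Measure (Bdry n), IsClarkMeasure I α μ := ⟨μ, hμ, fun ν hν => hν.unique hμ⟩
  rw [clarkMeasure, dif_pos h]
  exact Classical.choose_spec h.exists

end

end

/-! ### Measurability in `α` and disintegration -/

section

/-- Disintegration of integrable functions along a kernel. -/
lemma disintegration_of_bind_eq {X Y E : Type*} [MeasurableSpace X] [MeasurableSpace Y]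
    [NormedAddCommGroup E] [NormedSpace ℝ E] {m : Measure X} [SFinite m] {μ : Measure Y}
    {κ : ProbabilityTheory.Kernel X Y} [ProbabilityTheory.IsSFiniteKernel κ] (h : m.bind κ = μ)
    {g : Y → E} (hg : Integrable g μ) :
    (∀ g' : Y → E, g' =ᵐ[μ] g → ∀ᵐ x ∂m, g' =ᵐ[κ x] g) ∧
    (∀ᵐ x ∂m, Integrable g (κ x)) ∧
    Integrable (fun x => ∫ y, g y ∂κ x) m ∧ ∫ x, (∫ y, g y ∂κ x) ∂m = ∫ y, g y ∂μ := by
  subst h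
  have hg' := hg
  -- The mixture is read as a composition with a constant kernel, to which the integration theory of
  -- kernels applies.
  rw [Measure.comp_eq_comp_const_apply] at hg'
  refine ⟨fun g' hg' => Measure.ae_ae_of_ae_comp hg',
    ((Measure.integrable_comp_iff hg.1).1 hg).1, by simpa using hg'.integral_comp, ?_⟩
  rw [Measure.comp_eq_comp_const_apply, ProbabilityTheory.Kernel.integral_comp hg',
    ProbabilityTheory.Kernel.const_apply]

section

variable {k : ℕ} {n : Fin k → ℕ} {I : Ambient n → ℂ}

lemma continuous_herglotz_zero (hmaps : ∀ z ∈ dom n, ‖I z‖ < 1) :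
    Continuous fun α : Circle => herglotz I α 0 := by
  refine Complex.continuous_re.comp (Continuous.div (by fun_prop) (by fun_prop) fun α => ?_)
  exact circle_sub_ne_zero α (hmaps _ zero_mem_dom)

variable [∀ j, NeZero (n j)]

lemma measurable_integral_clarkMeasure (hI : DifferentiableOn ℂ I (dom n))
    (hmaps : ∀ z ∈ dom n, ‖I z‖ < 1) {f : Bdry n → ℝ} (hf : Continuous f) :
    Measurable fun α => ∫ ζ, f ζ ∂clarkMeasure I α := by
  refine measurable_of_tendsto_metrizable (f := fun (N : ℕ) α =>
    ∫ ζ, f ζ * herglotz I α (dilate (radius N) ζ) ∂bdryMeasure n) (fun N => ?_)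
    (tendsto_pi_nhds.2 fun α =>
      tendsto_integral_mul_herglotz (isClarkMeasure_clarkMeasure hI hmaps α) hf)
  have : Continuous fun p : Circle × Bdry n =>
      f p.2 * herglotz I p.1 (dilate (radius N) p.2) :=
    (hf.comp continuous_snd).mul (continuous_herglotz_dilate hI hmaps N)
  exact (this.stronglyMeasurable.integral_prod_right (ν := bdryMeasure n)).measurable

/-- Indicators of closed sets are limits of continuous functions, and closed sets form a π-system
generating the Borel sets. -/
lemma measurable_clarkMeasure (hI : DifferentiableOn ℂ I (dom n))
    (hmaps : ∀ z ∈ dom n, ‖I z‖ < 1) : Measurable (clarkMeasure I) := by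
  have hfin : ∀ α, IsFiniteMeasure (clarkMeasure I α) := fun α =>
    (isClarkMeasure_clarkMeasure hI hmaps α).finite
  have hl : ∀ f : BoundedContinuousFunction (Bdry n) NNReal,
      Measurable fun α => ∫⁻ ζ, f ζ ∂clarkMeasure I α := by
    intro f
    have h : Continuous fun ζ => (f ζ : ℝ) := NNReal.continuous_coe.comp f.continuous
    convert (measurable_integral_clarkMeasure hI hmaps h).ennreal_ofReal with α
    rw [← BoundedContinuousFunction.toReal_lintegral_coe_eq_integral, ENNReal.ofReal_toReal]
    exact (BoundedContinuousFunction.lintegral_lt_top_of_nnreal _ f).ne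
  have hclosed : ∀ s : Set (Bdry n), IsClosed s → Measurable fun α => clarkMeasure I α s :=
    fun s hs => measurable_of_tendsto_metrizable (fun N => hl (hs.apprSeq N))
      (tendsto_pi_nhds.2 fun α => HasOuterApproxClosed.tendsto_lintegral_apprSeq hs _)
  refine Measurable.measure_of_isPiSystem (S := {s : Set (Bdry n) | IsClosed s}) ?_
    isPiSystem_isClosed hclosed (hclosed _ isClosed_univ)
  rw [BorelSpace.measurable_eq (α := Bdry n), borel_eq_generateFrom_isClosed]

/-- The Clark measures of `I` as a kernel. -/
def clarkKernel (hI : DifferentiableOn ℂ I (dom n))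
    (hmaps : ∀ z ∈ dom n, ‖I z‖ < 1) : ProbabilityTheory.Kernel Circle (Bdry n) :=
  ⟨clarkMeasure I, measurable_clarkMeasure hI hmaps⟩

lemma clarkMeasure_univ (hI : DifferentiableOn ℂ I (dom n))
    (hmaps : ∀ z ∈ dom n, ‖I z‖ < 1) (α : Circle) :
    clarkMeasure I α Set.univ = ENNReal.ofReal (herglotz I α 0) := by
  obtain ⟨h1, h2⟩ := (isClarkMeasure_iff I α _).1 (isClarkMeasure_clarkMeasure hI hmaps α)
  rw [← h2 0 zero_mem_dom]
  simp [realPoisson_zero]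

/-- The mass of `σ_α` is continuous in `α`, hence bounded on the compact circle. -/
instance isFiniteKernel_clarkKernel (hI : DifferentiableOn ℂ I (dom n))
    (hmaps : ∀ z ∈ dom n, ‖I z‖ < 1) :
    ProbabilityTheory.IsFiniteKernel (clarkKernel hI hmaps) := by
  obtain ⟨C, hC⟩ := (isCompact_range (continuous_herglotz_zero hmaps)).isBounded.exists_norm_le
  refine ⟨ENNReal.ofReal C, ENNReal.ofReal_lt_top, fun α => ?_⟩
  refine (clarkMeasure_univ hI hmaps α).trans_le (ENNReal.ofReal_le_ofReal ?_)
  exact (le_abs_self _).trans (hC _ ⟨α, rfl⟩)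

/-- The disintegration formula for continuous functions. -/
lemma integral_integral_clarkMeasure_of_continuous (hI : DifferentiableOn ℂ I (dom n))
    (hmaps : ∀ z ∈ dom n, ‖I z‖ < 1) {f : Bdry n → ℝ} (hf : Continuous f) :
    ∫ α, ∫ ζ, f ζ ∂clarkMeasure I α ∂circleMeasure = ∫ ζ, f ζ ∂bdryMeasure n := by
  have hc : ∀ N, Continuous fun p : Circle × Bdry n =>
      f p.2 * herglotz I p.1 (dilate (radius N) p.2) := fun N =>
    (hf.comp continuous_snd).mul (continuous_herglotz_dilate hI hmaps N)
  have hd : ∀ N (ζ : Bdry n), dilate (radius N) ζ ∈ dom n := fun N =>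
    dilate_mem_dom (radius_pos N).le (radius_lt_one N)
  obtain ⟨M, hM⟩ := (isCompact_range hf).isBounded.exists_norm_le
  have hM' : ∀ ζ, |f ζ| ≤ M := fun ζ => hM _ ⟨ζ, rfl⟩
  have hlim : Tendsto (fun N => ∫ α, ∫ ζ, f ζ * herglotz I α (dilate (radius N) ζ) ∂bdryMeasure n
      ∂circleMeasure) atTop (𝓝 (∫ α, ∫ ζ, f ζ ∂clarkMeasure I α ∂circleMeasure)) := by
    refine tendsto_integral_of_dominated_convergence (fun α => M * herglotz I α 0) (fun N => ?_)
      ((integrable_of_continuous (continuous_herglotz_zero hmaps)).const_mul _)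
      (fun N => Eventually.of_forall fun α => ?_)
      (Eventually.of_forall fun α =>
        tendsto_integral_mul_herglotz (isClarkMeasure_clarkMeasure hI hmaps α) hf)
    · exact ((hc N).stronglyMeasurable.integral_prod_right
        (ν := bdryMeasure n)).aestronglyMeasurable
    · have hcα : Continuous fun ζ : Bdry n => herglotz I α (dilate (radius N) ζ) :=
        (continuous_herglotz_dilate hI hmaps N).comp
          (continuous_const.prodMk continuous_id : Continuous fun ζ : Bdry n => (α, ζ))
      rw [← integral_herglotz_dilate hI hmaps α N, ← integral_const_mul]
      refine (norm_integral_le_integral_norm _).trans ?_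
      refine integral_mono (integrable_of_continuous (hf.mul hcα).norm)
        ((integrable_of_continuous hcα).const_mul _) fun ζ => ?_
      have h0 := (herglotz_pos hmaps α (hd N ζ)).le
      simp only [norm_mul, Real.norm_eq_abs, abs_of_nonneg h0]
      exact mul_le_mul_of_nonneg_right (hM' ζ) h0
  -- At each fixed radius Fubini and the unit mean over `α` give `∫ f dΣ` exactly, so the sequence
  -- is constant.
  refine tendsto_nhds_unique hlim (tendsto_const_nhds.congr fun N => ?_)
  rw [integral_integral_swap_of_hasCompactSupport (hc N) (HasCompactSupport.of_compactSpace _)]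
  congr 1
  ext ζ
  rw [integral_const_mul]
  exact ((congrArg (f ζ * ·) (integral_re_add_div_sub (hmaps _ (hd N ζ)))).trans
    (mul_one _)).symm

lemma bind_clarkKernel (hI : DifferentiableOn ℂ I (dom n)) (hmaps : ∀ z ∈ dom n, ‖I z‖ < 1) :
    circleMeasure.bind (clarkKernel hI hmaps) = bdryMeasure n := by
  refine ext_of_forall_integral_eq_of_IsFiniteMeasure fun f => ?_
  -- Applied to the mixture itself, the disintegration lemma expresses its integrals as iterated
  -- ones.
  rw [← (disintegration_of_bind_eq rfl (integrable_of_continuous f.continuous)).2.2.2]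
  exact integral_integral_clarkMeasure_of_continuous hI hmaps f.continuous

end

end

end PolyBall

end

theorem mainTheorem4 (k : ℕ) (hk : 1 ≤ k) (n : Fin k → ℕ) (hn : ∀ j, 1 ≤ n j)
    (I : PolyBall.Ambient n → ℂ) (hI : PolyBall.IsInner I)
    (g : PolyBall.Bdry n → ℂ) (hg : Integrable g (PolyBall.bdryMeasure n)) :
    (∀ g' : PolyBall.Bdry n → ℂ, g' =ᵐ[PolyBall.bdryMeasure n] g →
      ∀ᵐ α ∂PolyBall.circleMeasure, g' =ᵐ[PolyBall.clarkMeasure I α] g) ∧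
    (∀ᵐ α ∂PolyBall.circleMeasure, Integrable g (PolyBall.clarkMeasure I α)) ∧
    Integrable (fun α : Circle => ∫ ζ, g ζ ∂(PolyBall.clarkMeasure I α))
      PolyBall.circleMeasure ∧
    ∫ α, (∫ ζ, g ζ ∂(PolyBall.clarkMeasure I α)) ∂PolyBall.circleMeasure =
      ∫ ζ, g ζ ∂(PolyBall.bdryMeasure n) := by
  have : ∀ j, NeZero (n j) := fun j => ⟨Nat.one_le_iff_ne_zero.1 (hn j)⟩
  exact PolyBall.disintegration_of_bind_eq (PolyBall.bind_clarkKernel hI.holo hI.maps) hg
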